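/- **Problem class.** Consider $$\min_{x\in\mathbb R^d} F_0(x):=f_0(x)+g(x)\quad\text{s.t. } Ax+b=0,\qquad g(x)=\bar g(\bar A x+\bar b), \tag{P}$$ where $f_0$ is differentiable with $L_f$-Lipschitz gradient, $\inf F_0>-\infty$, and $g,\bar g$ are proper, lower semicontinuous, convex functions with values in $\mathbb R\cup\{+\infty\}$. A point $x^*$ is *$\epsilon$-stationary* if for some $\gamma$ both $\mathrm{dist}(0,\nabla f_0(x^*)+A^\top\gamma+\partial g(x^*))\le\epsilon$ and $\|Ax^*+b\|\le\epsilon$; $x$ is *$\omega$-close* to $x^*$ if $\|x-x^*\|\le\omega$. Put $\Delta_{F_0}=F_0(x^{(0)})-\inf F_0$, and let $\kappa(M)=\sqrt{\lambda_{\max}(MM^\top)/\lambda_{\min}(MM^\top)}$ with $\lambda_{\max}$ the largest and $\lambda_{\min}$ the smallest positive eigenvalue; $[\bar A;A]$ is $\bar A$ stacked on $A$. **Methods.** A sequence $(x^{(t)})_{t\ge0}$ satisfies the *linear-span condition* for (P) if for every $t\ge1$ there are $\xi^{(t)}\in\mathrm{span}\big(\{A^\top b\}\cup\bigcup_{s<t}\{x^{(s)},\nabla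 f_0(x^{(s)}),A^\top A x^{(s)}\}\big)$ and $\zeta^{(t)}=\mathrm{prox}_{\eta g}(\xi^{(t)})$ for some $\eta>0$ with $x^{(t)}\in\mathrm{span}\{\xi^{(t)},\zeta^{(t)}\}$, where $\mathrm{prox}_{\eta g}(\xi)=\arg\min_z\{g(z)+\frac1{2\eta}\|z-\xi\|^2\}$. One oracle call is made per iteration, so $x^{(t)}$ is obtained with $t$ oracle calls. **Instance $\mathcal P$.** Let $\epsilon,L_f>0$; let $m_1\ge2$, $m_2\ge1$ be integers with $m_1m_2$ even, $m=3m_1m_2$, $\bar d\ge5$ odd, $d=m\bar d$, and write $x=(x_1,\dots,x_m)$ with $x_i\in\mathbb R^{\bar d}$. Let $J\in\mathbb R^{(m-1)\times m}$ have $-1$ in position $(i,i)$, $1$ in position $(i,i+1)$, and zeros elsewhere; let $\mathcal M=\{km_1:1\le k\le 3m_2-1\}$ and $\mathcal M^C=\{1,\dots,m-1\}\setminus\mathcal M$, and let $J_{\mathcal M},J_{\mathcal M^C}$ be the corresponding rows of $J$. Set $\bar A=mL_f\,J_{\mathcal M}\otimes I_{\bar d}$, $A=mL_f\,J_{\mathcal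 M^C}\otimes I_{\bar d}$, $b=0$, $\bar b=0$, and $\bar g(y)=\frac{\beta}{mL_f}\|y\|_1$, so that $g(x)=\beta\sum_{i\in\mathcal M}\|x_i-x_{i+1}\|_1$, where $\beta>(50\pi+1+\|A\|)\sqrt m\,\epsilon$ ($\|A\|$ the spectral norm). Let $\Psi(u)=0$ for $u\le0$, $\Psi(u)=1-e^{-u^2}$ for $u>0$, $\Phi(v)=4\arctan v+2\pi$, $\varphi(z,1)=-\Psi(1)\Phi(z_1)$, and $\varphi(z,j)=\Psi(-z_{j-1})\Phi(-z_j)-\Psi(z_{j-1})\Phi(z_j)$ for $2\le j\le\bar d$. Let $h_i(z)$ be $\varphi(z,1)+3\sum_{j=1}^{\lfloor\bar d/2\rfloor}\varphi(z,2j)$ for $1\le i\le\frac m3$, $\varphi(z,1)$ for $\frac m3<i\le\frac{2m}3$, and $\varphi(z,1)+3\sum_{j=1}^{\lfloor\bar d/2\rfloor}\varphi(z,2j+1)$ for $\frac{2m}3<i\le m$. Finally $$f_0(x)=\sum_{i=1}^m f_i(x_i),\qquad f_i(z)=\frac{300\pi\epsilon^2}{mL_f}\,h_i\!\left(\frac{\sqrt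 m\,L_f\,z}{150\pi\epsilon}\right).$$ **Theorem.** For all $\epsilon>0$, $L_f>0$ and all $m_1,m_2,\bar d,\beta$ as above, $\mathcal P$ and all its translates belong to the problem class (with constant $L_f$), $F_0$ is finite-valued, and for every $\omega\in[0,\frac{150\pi\epsilon}{L_f})$: if $(x^{(t)})$ satisfies the linear-span condition for $\mathcal P$ with $x^{(0)}=0$, and $x^{(t)}$ is $\omega$-close to an $\epsilon$-stationary point of $\mathcal P$, then $$t\;\ge\;\left\lceil\frac{\kappa([\bar A;A])\,L_f\,\Delta_{F_0}}{36000\,\pi^2\,\epsilon^2}\right\rceil .$$ That is, any such method needs at least this many oracle calls. For an arbitrary starting point $x^{(0)}$ the same bound holds for the translated instance $\min f_0(x-x^{(0)})+g(x-x^{(0)})$ s.t. $A(x-x^{(0)})+b=0$, whenever the shifted sequence $x^{(t)}-x^{(0)}$ satisfies the linear-span condition for $\mathcal P$. -/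

import Mathlib

open scoped Kronecker

noncomputable section

namespace LowerBound

/-! ### Convex analysis for extended-valued functions -/

/-- Proper, lower semicontinuous and convex (convexity is convexity of the epigraph). -/
structure ProperLscConvex {ι : Type*} [Fintype ι] (g : EuclideanSpace ℝ ι → EReal) : Prop where
  ne_bot : ∀ x, g x ≠ ⊥
  exists_ne_top : ∃ x, g x ≠ ⊤
  lsc : LowerSemicontinuous g
  convex : Convex ℝ {p : EuclideanSpace ℝ ι × ℝ | g p.1 ≤ (p.2 : EReal)}

/-- The convex subdifferential `∂g(x)`; it is empty outside the domain of `g`. -/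
def subdifferential {ι : Type*} [Fintype ι] (g : EuclideanSpace ℝ ι → EReal)
    (x : EuclideanSpace ℝ ι) : Set (EuclideanSpace ℝ ι) :=
  {v | g x ≠ ⊤ ∧ ∀ y, g x + ((inner ℝ v (y - x) : ℝ) : EReal) ≤ g y}

/-- `ζ` is a minimizer of `z ↦ g(z) + ‖z - ξ‖² / (2η)`, that is, `ζ = prox_{ηg}(ξ)`. -/
def IsProx {ι : Type*} [Fintype ι] (g : EuclideanSpace ℝ ι → EReal) (η : ℝ)
    (ξ ζ : EuclideanSpace ℝ ι) : Prop :=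
  ∀ z, g ζ + ((1 / (2 * η) * ‖ζ - ξ‖ ^ 2 : ℝ) : EReal) ≤
    g z + ((1 / (2 * η) * ‖z - ξ‖ ^ 2 : ℝ) : EReal)

/-! ### Matrices -/

/-- The spectral norm of a real matrix. -/
def spectralNorm {κ ι : Type*} [Fintype κ] [Fintype ι] [DecidableEq ι]
    (M : Matrix κ ι ℝ) : ℝ :=
  ‖LinearMap.toContinuousLinearMap (Matrix.toEuclideanLin M)‖

/-- The square root of the ratio of the largest to the smallest positive eigenvalue of `M Mᵀ`. -/
def condNumber {κ ι : Type*} [Fintype κ] [Fintype ι] [DecidableEq κ] (M : Matrix κ ι ℝ) : ℝ :=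
  √(sSup {μ : ℝ | Module.End.HasEigenvalue (Matrix.toLin' (M * M.transpose)) μ} /
    sInf {μ : ℝ | 0 < μ ∧ Module.End.HasEigenvalue (Matrix.toLin' (M * M.transpose)) μ})

/-! ### The problem class -/

/-- The data of `min f₀(x) + g(x)` subject to `A x + b = 0`, where `g(x) = ḡ(Ā x + b̄)`. -/
structure Problem (ι κ κ' : Type) [Fintype ι] [Fintype κ] [Fintype κ'] where
  f₀ : EuclideanSpace ℝ ι → ℝ
  A : Matrix κ ι ℝ
  b : EuclideanSpace ℝ κ
  Abar : Matrix κ' ι ℝ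
  bbar : EuclideanSpace ℝ κ'
  gbar : EuclideanSpace ℝ κ' → EReal

namespace Problem

variable {ι κ κ' : Type} [Fintype ι] [Fintype κ] [Fintype κ']
  [DecidableEq ι] [DecidableEq κ] [DecidableEq κ']

def g (P : Problem ι κ κ') (x : EuclideanSpace ℝ ι) : EReal :=
  P.gbar (Matrix.toEuclideanLin P.Abar x + P.bbar)

def F₀ (P : Problem ι κ κ') (x : EuclideanSpace ℝ ι) : EReal :=
  (P.f₀ x : EReal) + P.g x

/-- The standing assumptions on the problem: `f₀` is differentiable with `L`-Lipschitz gradient,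
`F₀` is bounded below, and `g`, `ḡ` are proper, lower semicontinuous and convex. -/
structure Admissible (P : Problem ι κ κ') (L : ℝ) : Prop where
  differentiable : Differentiable ℝ P.f₀
  gradient_lipschitz : ∀ x x', ‖gradient P.f₀ x - gradient P.f₀ x'‖ ≤ L * ‖x - x'‖
  bounded_below : ⊥ < ⨅ x, P.F₀ x
  proper_g : ProperLscConvex P.g
  proper_gbar : ProperLscConvex P.gbar

/-- `κ([Ā; A])`. -/
def jointCond (P : Problem ι κ κ') : ℝ := condNumber (Matrix.fromRows P.Abar P.A)

/-- `Δ_{F₀} = F₀(x⁰) - inf F₀`. -/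
def gap (P : Problem ι κ κ') (x₀ : EuclideanSpace ℝ ι) : ℝ :=
  (P.F₀ x₀ - ⨅ x, P.F₀ x).toReal

/-- `x` is an `ε`-stationary point: for some multiplier `γ`, both
`dist(0, ∇f₀(x) + Aᵀγ + ∂g(x))` and `‖A x + b‖` are at most `ε`
(the distance to the empty set is infinite). -/
def IsStationary (P : Problem ι κ κ') (ε : ℝ) (x : EuclideanSpace ℝ ι) : Prop :=
  ∃ γ : EuclideanSpace ℝ κ,
    Metric.infEDist 0 ((fun v => gradient P.f₀ x + Matrix.toEuclideanLin P.A.transpose γ + v) ''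
      subdifferential P.g x) ≤ ENNReal.ofReal ε ∧
    ‖Matrix.toEuclideanLin P.A x + P.b‖ ≤ ε

/-- `x` is `ω`-close to an `ε`-stationary point. -/
def IsNearStationary (P : Problem ι κ κ') (ω ε : ℝ) (x : EuclideanSpace ℝ ι) : Prop :=
  ∃ x' : EuclideanSpace ℝ ι, P.IsStationary ε x' ∧ ‖x - x'‖ ≤ ω

/-- The linear-span condition on the iterates of a first-order method. The iterate `x t` is
produced after `t` oracle calls, one per iteration. -/
def LinearSpan (P : Problem ι κ κ') (x : ℕ → EuclideanSpace ℝ ι) : Prop :=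
  ∀ t : ℕ, 1 ≤ t → ∃ ξ ζ : EuclideanSpace ℝ ι,
    ξ ∈ Submodule.span ℝ ({Matrix.toEuclideanLin P.A.transpose P.b} ∪
      ⋃ s : Fin t, {x s, gradient P.f₀ (x s),
        Matrix.toEuclideanLin P.A.transpose (Matrix.toEuclideanLin P.A (x s))}) ∧
    (∃ η : ℝ, 0 < η ∧ IsProx P.g η ξ ζ) ∧
    x t ∈ Submodule.span ℝ {ξ, ζ}

/-- The same problem in the variable `x - c`:
`min f₀(x - c) + g(x - c)` subject to `A (x - c) + b = 0`. -/
def translate (P : Problem ι κ κ') (c : EuclideanSpace ℝ ι) : Problem ι κ κ' where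
  f₀ := fun x => P.f₀ (x - c)
  A := P.A
  b := P.b - Matrix.toEuclideanLin P.A c
  Abar := P.Abar
  bbar := P.bbar - Matrix.toEuclideanLin P.Abar c
  gbar := P.gbar

end Problem

/-! ### The hard instance

Blocks, rows and coordinates are numbered from `0` in `Fin`, from `1` in the usual formulas. -/

/-- The `(p-1) × p` difference matrix with rows `(…, -1, 1, …)`. -/
def J (p : ℕ) : Matrix (Fin (p - 1)) (Fin p) ℝ :=
  Matrix.of fun i j => if (j : ℕ) = i then -1 else if (j : ℕ) = i + 1 then 1 else 0

/-- The rows of `J_m`, `m = 3m₁m₂`, numbered by `ℳ = {k m₁ : 1 ≤ k ≤ 3m₂ - 1}`; these are the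
multiples of `m₁` among the row numbers `1, …, m - 1`. -/
abbrev RowM (m₁ m₂ : ℕ) : Type := {r : Fin (3 * m₁ * m₂ - 1) // m₁ ∣ (r : ℕ) + 1}

/-- The remaining rows of `J_m`. -/
abbrev RowMc (m₁ m₂ : ℕ) : Type := {r : Fin (3 * m₁ * m₂ - 1) // ¬ m₁ ∣ (r : ℕ) + 1}

/-- `Ā = m L · J_ℳ ⊗ I`. -/
def hardAbar (m₁ m₂ dbar : ℕ) (L : ℝ) :
    Matrix (RowM m₁ m₂ × Fin dbar) (Fin (3 * m₁ * m₂) × Fin dbar) ℝ :=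
  (((3 * m₁ * m₂ : ℕ) : ℝ) * L) •
    ((J (3 * m₁ * m₂)).submatrix Subtype.val id ⊗ₖ (1 : Matrix (Fin dbar) (Fin dbar) ℝ))

/-- `A = m L · J_{ℳᶜ} ⊗ I`. -/
def hardA (m₁ m₂ dbar : ℕ) (L : ℝ) :
    Matrix (RowMc m₁ m₂ × Fin dbar) (Fin (3 * m₁ * m₂) × Fin dbar) ℝ :=
  (((3 * m₁ * m₂ : ℕ) : ℝ) * L) •
    ((J (3 * m₁ * m₂)).submatrix Subtype.val id ⊗ₖ (1 : Matrix (Fin dbar) (Fin dbar) ℝ))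

def Psi (u : ℝ) : ℝ := if u ≤ 0 then 0 else 1 - Real.exp (-u ^ 2)

def Phi (v : ℝ) : ℝ := 4 * Real.arctan v + 2 * Real.pi

/-- The coordinate `[z]_j`, numbered from `1` (and `0` out of range, which is never used). -/
def coord {dbar : ℕ} (z : Fin dbar → ℝ) (j : ℕ) : ℝ :=
  if h : 1 ≤ j ∧ j ≤ dbar then z ⟨j - 1, by omega⟩ else 0

/-- The chain link `φ(z, j)`, `j = 1, …, d̄`. -/
def link {dbar : ℕ} (z : Fin dbar → ℝ) (j : ℕ) : ℝ :=
  if j = 1 then -Psi 1 * Phi (coord z 1)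
  else Psi (-coord z (j - 1)) * Phi (-coord z j) - Psi (coord z (j - 1)) * Phi (coord z j)

/-- `h_i` for the `i`-th of `m = 3q` blocks: even links in the first third of the blocks, odd
links in the last third. -/
def blockH (q : ℕ) {dbar : ℕ} (i : ℕ) (z : Fin dbar → ℝ) : ℝ :=
  if i < q then link z 1 + 3 * ∑ j ∈ Finset.Icc 1 (dbar / 2), link z (2 * j)
  else if i < 2 * q then link z 1
  else link z 1 + 3 * ∑ j ∈ Finset.Icc 1 (dbar / 2), link z (2 * j + 1)

/-- `f_i(z) = (300 π ε² / (m L)) h_i(√m L z / (150 π ε))`, `m = 3q`. -/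
def blockF (q : ℕ) {dbar : ℕ} (L ε : ℝ) (i : ℕ) (z : Fin dbar → ℝ) : ℝ :=
  300 * Real.pi * ε ^ 2 / (((3 * q : ℕ) : ℝ) * L) *
    blockH q i (fun j => √((3 * q : ℕ) : ℝ) * L * z j / (150 * Real.pi * ε))

/-- The hard instance: `f₀(x) = ∑ f_i(x_i)`, `ḡ(y) = (β / (m L)) ‖y‖₁`, and `b = 0`, `b̄ = 0`. -/
def hardInstance (m₁ m₂ dbar : ℕ) (L ε β : ℝ) :
    Problem (Fin (3 * m₁ * m₂) × Fin dbar) (RowMc m₁ m₂ × Fin dbar) (RowM m₁ m₂ × Fin dbar) where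
  f₀ := fun x => ∑ i : Fin (3 * m₁ * m₂), blockF (m₁ * m₂) L ε i (fun j => x (i, j))
  A := hardA m₁ m₂ dbar L
  b := 0
  Abar := hardAbar m₁ m₂ dbar L
  bbar := 0
  gbar := fun y => ((β / (((3 * m₁ * m₂ : ℕ) : ℝ) * L) * ∑ k, |y k| : ℝ) : EReal)

end LowerBound

end

noncomputable section

namespace LowerBound

/-! The instance is a zero-chain spread over `m = 3q` blocks, `q = m₁m₂`. For `1 ≤ j ≤ d̄` the
weights of the link `φ(·, j)` over all blocks sum to `m` (`sum_weight`), so when the blocks agree,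
`f₀` is, up to scaling, the full chain `∑ⱼ φ(z, j)`. Both partial derivatives of a link are
nonpositive, and the second one is at most `-5/4` where the chain drops from absolute value at least
`1` to below `1` (`lamV_le_of_one_le_abs`). Hence the chain has a large gradient until every
coordinate is at least `1` in absolute value.

At an `ε`-stationary point the residual is tested against indicators of the first `n` blocks with
`m₁ ∣ n`, which lie in the kernel of `A` and so remove the multiplier. Since `β` is large, jumps
across `ℳ` are impossible; `‖A x‖ ≤ ε` keeps the other jumps small. The blocks therefore nearly
agree, their average is nearly stationary for the full chain, and its last coordinate is at least
`1` in absolute value after scaling. A point whose last coordinate vanishes in every block is then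
too far away to be `ω`-close (`exists_last_ne_zero`).

On the other hand, supports grow slowly. Beyond the first link, even links sit only in the first
third of the blocks and odd links only in the last third, so between two consecutive new coordinates
the support must cross the middle third. The proximal map crosses rows of `ℳ` for free, but a row of
`ℳᶜ` is crossed only by `AᵀA`, one per iteration, and the middle third contains `m₁m₂ - m₂ ≥ m₁m₂/2`
of them. The function `activation` records this timetable, `LinearSpan.eq_zero_of_lt_activation`
proves it by induction, and `mul_le_of_activation_le` extracts `m₁m₂d̄ ≤ 5t`.

Finally `κ ≤ 2m = 6m₁m₂` (`condNumber_hard_le`) and `Δ ≤ 1200π²ε²d̄/L` (`hardInstance_gap_le`), so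
`κLΔ ≤ 7200π²ε²m₁m₂d̄ ≤ 36000π²ε²t`. Other starting points reduce to the origin by a change of
variables. -/

/-! ### The scalar functions -/

/-- The derivative of `Psi`. -/
def dPsi (u : ℝ) : ℝ := 2 * max u 0 * Real.exp (-(max u 0) ^ 2)

/-- The derivative of `Phi`. -/
def dPhi (v : ℝ) : ℝ := 4 * (1 / (1 + v ^ 2))

theorem Psi_eq (u : ℝ) : Psi u = 1 - Real.exp (-(max u 0) ^ 2) := by
  unfold Psi
  split_ifs with h
  · simp [max_eq_right h]
  · rw [max_eq_left (le_of_not_ge h)]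

theorem hasDerivAt_max_zero_sq (u : ℝ) :
    HasDerivAt (fun u : ℝ => (max u 0) ^ 2) (2 * max u 0) u := by
  rcases lt_trichotomy u 0 with h | rfl | h
  · have : (fun u : ℝ => (max u 0) ^ 2) =ᶠ[nhds u] fun _ => 0 := by
      filter_upwards [gt_mem_nhds h] with x hx
      simp [max_eq_right hx.le]
    rw [max_eq_right h.le, mul_zero]
    exact (hasDerivAt_const u (0 : ℝ)).congr_of_eventuallyEq this
  · rw [max_self, mul_zero, hasDerivAt_iff_isLittleO]
    simp only [max_self, sub_zero, smul_zero, ne_eq, OfNat.ofNat_ne_zero, not_false_eq_true,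
      zero_pow]
    have h1 : (fun x : ℝ => (max x 0) ^ 2) =O[nhds 0] fun x : ℝ => x ^ 2 := by
      refine Asymptotics.IsBigO.of_bound 1 (Filter.Eventually.of_forall fun x => ?_)
      rw [one_mul, norm_pow, norm_pow]
      gcongr
      rw [Real.norm_eq_abs, Real.norm_eq_abs]
      rcases le_total x 0 with h | h <;> simp [h]
    exact h1.trans_isLittleO (Asymptotics.isLittleO_pow_id (by norm_num))
  · have : (fun u : ℝ => (max u 0) ^ 2) =ᶠ[nhds u] fun u => u ^ 2 := by
      filter_upwards [lt_mem_nhds h] with x hx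
      simp [max_eq_left hx.le]
    rw [max_eq_left h.le]
    simpa using (hasDerivAt_pow 2 u).congr_of_eventuallyEq this

theorem hasDerivAt_Psi (u : ℝ) : HasDerivAt Psi (dPsi u) u := by
  have h := ((hasDerivAt_max_zero_sq u).neg.exp).const_sub 1
  have e : Psi = fun u => 1 - Real.exp (-(max u 0) ^ 2) := funext Psi_eq
  rw [e]
  refine h.congr_deriv ?_
  unfold dPsi
  simp only [Pi.neg_apply]
  ring

theorem hasDerivAt_Phi (v : ℝ) : HasDerivAt Phi (dPhi v) v := by
  unfold dPhi
  exact ((Real.hasDerivAt_arctan v).const_mul 4).add_const (2 * Real.pi)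

theorem Psi_nonneg (u : ℝ) : 0 ≤ Psi u := by
  rw [Psi_eq, sub_nonneg, Real.exp_le_one_iff]
  nlinarith [sq_nonneg (max u 0)]

theorem Psi_le_one (u : ℝ) : Psi u ≤ 1 := by
  rw [Psi_eq]
  linarith [Real.exp_pos (-(max u 0) ^ 2)]

theorem Psi_of_nonpos {u : ℝ} (h : u ≤ 0) : Psi u = 0 := by simp [Psi, h]

theorem Psi_add_neg_le_one (u : ℝ) : Psi (-u) + Psi u ≤ 1 := by
  rcases le_total u 0 with h | h
  · rw [Psi_of_nonpos h]; linarith [Psi_le_one (-u)]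
  · rw [Psi_of_nonpos (neg_nonpos.2 h)]; linarith [Psi_le_one u]

theorem dPsi_of_nonpos {u : ℝ} (h : u ≤ 0) : dPsi u = 0 := by simp [dPsi, h]

theorem dPsi_nonneg (u : ℝ) : 0 ≤ dPsi u := by
  unfold dPsi; positivity

theorem dPsi_le_one (u : ℝ) : dPsi u ≤ 1 := by
  unfold dPsi
  rw [Real.exp_neg, ← div_eq_mul_inv, div_le_one (Real.exp_pos _)]
  nlinarith [Real.add_one_le_exp ((max u 0) ^ 2), sq_nonneg (max u 0 - 1)]

theorem Phi_nonneg (v : ℝ) : 0 ≤ Phi v := by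
  unfold Phi; linarith [Real.neg_pi_div_two_lt_arctan v]

theorem Phi_le (v : ℝ) : Phi v ≤ 4 * Real.pi := by
  unfold Phi; linarith [Real.arctan_lt_pi_div_two v]

theorem dPhi_nonneg (v : ℝ) : 0 ≤ dPhi v := by unfold dPhi; positivity

theorem dPhi_le (v : ℝ) : dPhi v ≤ 4 := by
  unfold dPhi
  have : 1 / (1 + v ^ 2) ≤ 1 := by
    rw [div_le_one (by positivity)]; nlinarith [sq_nonneg v]
  linarith

theorem dPhi_neg (v : ℝ) : dPhi (-v) = dPhi v := by simp [dPhi]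

theorem abs_sub_le_of_abs_deriv_le {f f' : ℝ → ℝ} {C : ℝ} (hf : ∀ x, HasDerivAt f (f' x) x)
    (hC : ∀ x, |f' x| ≤ C) (x y : ℝ) : |f x - f y| ≤ C * |x - y| := by
  simpa using Convex.norm_image_sub_le_of_norm_hasDerivWithin_le (s := Set.univ)
    (fun x _ => (hf x).hasDerivWithinAt) (fun x _ => hC x) convex_univ
    (Set.mem_univ y) (Set.mem_univ x)

theorem abs_Psi_sub_le (x y : ℝ) : |Psi x - Psi y| ≤ |x - y| := by
  rw [← one_mul |x - y|]
  exact abs_sub_le_of_abs_deriv_le hasDerivAt_Psi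
    (fun x => by rw [abs_of_nonneg (dPsi_nonneg x)]; exact dPsi_le_one x) x y

theorem abs_Phi_sub_le (x y : ℝ) : |Phi x - Phi y| ≤ 4 * |x - y| :=
  abs_sub_le_of_abs_deriv_le hasDerivAt_Phi
    (fun x => by rw [abs_of_nonneg (dPhi_nonneg x)]; exact dPhi_le x) x y

theorem abs_dPhi_sub_le (x y : ℝ) : |dPhi x - dPhi y| ≤ 3 * |x - y| := by
  refine abs_sub_le_of_abs_deriv_le (f' := fun v => 4 * (-(2 * v) / (1 + v ^ 2) ^ 2)) ?_ ?_ x y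
  · intro v
    have h1 : HasDerivAt (fun v : ℝ => 1 + v ^ 2) (2 * v) v := by
      simpa using (hasDerivAt_pow 2 v).const_add 1
    have h := (h1.inv (by positivity)).const_mul 4
    have e : dPhi = fun v => 4 * (1 + v ^ 2)⁻¹ := by funext v; simp [dPhi]
    rw [e]
    exact h
  · intro v
    have hp : 0 < (1 + v ^ 2) ^ 2 := by positivity
    have e : 4 * (-(2 * v) / (1 + v ^ 2) ^ 2) = (-8 * v) / (1 + v ^ 2) ^ 2 := by ring
    rw [e, abs_div, abs_of_pos hp, div_le_iff₀ hp, abs_le]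
    constructor <;> nlinarith [sq_nonneg (v ^ 2), sq_nonneg (3 * v - 2), sq_nonneg (3 * v + 2)]

/-- `dPsi` has a kink at `0`, so the derivative bound is applied to the smooth function `2u
exp(-u²)` and then composed with the 1-Lipschitz map `max · 0`. -/
theorem abs_dPsi_sub_le (x y : ℝ) : |dPsi x - dPsi y| ≤ 2 * |x - y| := by
  have key : ∀ x y : ℝ, |2 * x * Real.exp (-x ^ 2) - 2 * y * Real.exp (-y ^ 2)| ≤ 2 * |x - y| := by
    refine abs_sub_le_of_abs_deriv_le
      (f := fun u => 2 * u * Real.exp (-u ^ 2))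
      (f' := fun u => (2 - 4 * u ^ 2) * Real.exp (-u ^ 2)) ?_ ?_
    · intro u
      have h1 : HasDerivAt (fun u : ℝ => -u ^ 2) (-(2 * u)) u := by
        exact (hasDerivAt_pow 2 u).neg.congr_deriv (by simp)
      have h2 : HasDerivAt (fun u : ℝ => 2 * u) 2 u := by
        simpa using (hasDerivAt_id u).const_mul 2
      refine (h2.mul h1.exp).congr_deriv ?_
      ring
    · intro u
      have hp := Real.exp_pos (u ^ 2)
      have h3 := Real.quadratic_le_exp_of_nonneg (sq_nonneg u)
      rw [Real.exp_neg, ← div_eq_mul_inv, abs_div, abs_of_pos hp, div_le_iff₀ hp, abs_le]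
      constructor <;> nlinarith [sq_nonneg (u ^ 2 - 1), sq_nonneg u]
  refine (key (max x 0) (max y 0)).trans ?_
  exact mul_le_mul_of_nonneg_left (abs_max_sub_max_le_abs x y 0) (by norm_num)

/-! ### The two-variable link -/

/-- The link `φ(z, j)` as a function of `u = z_{j-1}` and `v = z_j`. -/
def lam (u v : ℝ) : ℝ := Psi (-u) * Phi (-v) - Psi u * Phi v

/-- The partial derivative of `lam` in the first variable. -/
def lamU (u v : ℝ) : ℝ := -(dPsi (-u) * Phi (-v)) - dPsi u * Phi v

/-- The partial derivative of `lam` in the second variable. -/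
def lamV (u v : ℝ) : ℝ := -((Psi (-u) + Psi u) * dPhi v)

theorem lam_ge (u v : ℝ) : -(4 * Real.pi) ≤ lam u v := by
  unfold lam
  have h1 := mul_nonneg (Psi_nonneg (-u)) (Phi_nonneg (-v))
  have h2 : Psi u * Phi v ≤ 1 * (4 * Real.pi) :=
    mul_le_mul (Psi_le_one u) (Phi_le v) (Phi_nonneg v) zero_le_one
  linarith

theorem lam_zero_left (v : ℝ) : lam 0 v = 0 := by simp [lam, Psi]

theorem lam_one_zero_nonpos : lam 1 0 ≤ 0 := by
  unfold lam
  rw [Psi_of_nonpos (by norm_num : (-1 : ℝ) ≤ 0)]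
  have := mul_nonneg (Psi_nonneg 1) (Phi_nonneg 0)
  linarith

theorem lamU_nonpos (u v : ℝ) : lamU u v ≤ 0 := by
  unfold lamU
  have h1 := mul_nonneg (dPsi_nonneg (-u)) (Phi_nonneg (-v))
  have h2 := mul_nonneg (dPsi_nonneg u) (Phi_nonneg v)
  linarith

theorem lamV_nonpos (u v : ℝ) : lamV u v ≤ 0 := by
  unfold lamV
  have := mul_nonneg (add_nonneg (Psi_nonneg (-u)) (Psi_nonneg u)) (dPhi_nonneg v)
  linarith

theorem lamU_zero_left (v : ℝ) : lamU 0 v = 0 := by simp [lamU, dPsi]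

theorem lamV_zero_left (v : ℝ) : lamV 0 v = 0 := by simp [lamV, Psi]

/-- `dPsi` vanishes on the nonpositive half-line, so at most one of the two summands is nonzero and
the bound is not doubled. -/
theorem abs_lamU_le (u v : ℝ) : |lamU u v| ≤ 4 * Real.pi := by
  rw [abs_of_nonpos (lamU_nonpos u v)]
  unfold lamU
  have key : ∀ u v, dPsi u * Phi v ≤ 1 * (4 * Real.pi) := fun u v =>
    mul_le_mul (dPsi_le_one u) (Phi_le v) (Phi_nonneg v) zero_le_one
  rcases le_total u 0 with h | h
  · rw [dPsi_of_nonpos h]; linarith [key (-u) (-v)]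
  · rw [dPsi_of_nonpos (neg_nonpos.2 h)]; linarith [key u v]

theorem abs_lamV_le (u v : ℝ) : |lamV u v| ≤ 4 := by
  rw [abs_of_nonpos (lamV_nonpos u v)]
  unfold lamV
  have := mul_le_mul (Psi_add_neg_le_one u) (dPhi_le v) (dPhi_nonneg v) zero_le_one
  linarith

theorem abs_mul_sub_mul_le {a a' b b' A B : ℝ} (ha : |a'| ≤ A) (hb : |b| ≤ B) :
    |a * b - a' * b'| ≤ B * |a - a'| + A * |b - b'| := by
  have e : a * b - a' * b' = b * (a - a') + a' * (b - b') := by ring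
  rw [e]
  refine (abs_add_le _ _).trans ?_
  rw [abs_mul, abs_mul]
  gcongr

theorem abs_lamU_sub_le (u v u' v' : ℝ) :
    |lamU u v - lamU u' v'| ≤ 16 * Real.pi * |u - u'| + 8 * |v - v'| := by
  have key : ∀ u v u' v', |dPsi u * Phi v - dPsi u' * Phi v'| ≤
      8 * Real.pi * |u - u'| + 4 * |v - v'| := by
    intro u v u' v'
    have h := abs_mul_sub_mul_le (a := dPsi u) (a' := dPsi u') (b := Phi v) (b' := Phi v')
      (A := 1) (B := 4 * Real.pi) (by rw [abs_of_nonneg (dPsi_nonneg u')]; exact dPsi_le_one u')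
      (by rw [abs_of_nonneg (Phi_nonneg v)]; exact Phi_le v)
    have h1 := mul_le_mul_of_nonneg_left (abs_dPsi_sub_le u u')
      (by positivity : 0 ≤ 4 * Real.pi)
    linarith [abs_Phi_sub_le v v']
  have h1 := key u v u' v'
  have h2 := key (-u) (-v) (-u') (-v')
  rw [← neg_sub', abs_neg, ← neg_sub', abs_neg] at h2
  have e : lamU u v - lamU u' v' = -(dPsi u * Phi v - dPsi u' * Phi v') -
    (dPsi (-u) * Phi (-v) - dPsi (-u') * Phi (-v')) := by unfold lamU; ring
  rw [e]
  refine (abs_sub _ _).trans ?_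
  rw [abs_neg]
  linarith

/-- The sum is `Psi |u|`, which keeps the Lipschitz constant at `1` rather than `2`. -/
theorem abs_Psi_add_neg_sub_le (u u' : ℝ) :
    |(Psi (-u) + Psi u) - (Psi (-u') + Psi u')| ≤ |u - u'| := by
  have key : ∀ u, Psi (-u) + Psi u = Psi |u| := by
    intro u
    rcases le_total u 0 with h | h
    · rw [Psi_of_nonpos h, abs_of_nonpos h, add_zero]
    · rw [Psi_of_nonpos (neg_nonpos.2 h), abs_of_nonneg h, zero_add]
  rw [key, key]
  exact (abs_Psi_sub_le _ _).trans (abs_abs_sub_abs_le _ _)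

theorem abs_lamV_sub_le (u v u' v' : ℝ) :
    |lamV u v - lamV u' v'| ≤ 4 * |u - u'| + 3 * |v - v'| := by
  have h := abs_mul_sub_mul_le (a := Psi (-u) + Psi u) (a' := Psi (-u') + Psi u') (b := dPhi v)
      (b' := dPhi v') (A := 1) (B := 4)
      (by rw [abs_of_nonneg (add_nonneg (Psi_nonneg _) (Psi_nonneg _))]
          exact Psi_add_neg_le_one u')
      (by rw [abs_of_nonneg (dPhi_nonneg v)]; exact dPhi_le v)
  have e : lamV u v - lamV u' v' =
    -((Psi (-u) + Psi u) * dPhi v - (Psi (-u') + Psi u') * dPhi v') := by unfold lamV; ring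
  rw [e, abs_neg]
  linarith [abs_dPhi_sub_le v v', abs_Psi_add_neg_sub_le u u']

/-- The gradient cannot be small where the chain breaks off: `Psi |u| ≥ 1 - 1/e ≥ 5/8` and `dPhi v ≥
2`. The value `5/4` must exceed the `9/8` in `one_le_abs_of_sum_chainDeriv`. -/
theorem lamV_le_of_one_le_abs {u v : ℝ} (hu : 1 ≤ |u|) (hv : |v| < 1) :
    lamV u v ≤ -(5 / 4) := by
  have hone : 5 / 8 ≤ Psi 1 := by
    have h : Psi 1 = 1 - (Real.exp 1)⁻¹ := by
      rw [Psi_eq]; norm_num [Real.exp_neg]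
    have h3 : (Real.exp 1)⁻¹ ≤ 3 / 8 := by
      rw [inv_le_comm₀ (Real.exp_pos _) (by norm_num)]
      linarith [Real.exp_one_gt_d9]
    linarith
  have hmono : Monotone Psi := monotone_of_hasDerivAt_nonneg hasDerivAt_Psi dPsi_nonneg
  have h1 : 5 / 8 ≤ Psi (-u) + Psi u := by
    rcases le_abs'.1 hu with h | h
    · have := hmono (show (1 : ℝ) ≤ -u by linarith)
      linarith [Psi_nonneg u]
    · have := hmono h
      linarith [Psi_nonneg (-u)]
  have h2 : 2 ≤ dPhi v := by
    unfold dPhi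
    have : v ^ 2 ≤ 1 := by nlinarith [abs_lt.1 hv]
    have : 1 / 2 ≤ 1 / (1 + v ^ 2) := one_div_le_one_div_of_le (by positivity) (by linarith)
    linarith
  unfold lamV
  nlinarith

theorem hasDerivAt_Psi_neg (u : ℝ) : HasDerivAt (fun u => Psi (-u)) (-dPsi (-u)) u := by
  exact ((hasDerivAt_Psi (-u)).scomp u (hasDerivAt_neg u)).congr_deriv (by simp)

theorem hasDerivAt_Phi_neg (v : ℝ) : HasDerivAt (fun v => Phi (-v)) (-dPhi (-v)) v := by
  exact ((hasDerivAt_Phi (-v)).scomp v (hasDerivAt_neg v)).congr_deriv (by simp)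

theorem HasFDerivAt.lam {E : Type*} [NormedAddCommGroup E] [NormedSpace ℝ E] {U V : E → ℝ}
    {U' V' : E →L[ℝ] ℝ} {x : E} (hU : HasFDerivAt U U' x) (hV : HasFDerivAt V V' x) :
    HasFDerivAt (fun x => lam (U x) (V x)) (lamU (U x) (V x) • U' + lamV (U x) (V x) • V') x := by
  have h1 := ((hasDerivAt_Psi_neg (U x)).comp_hasFDerivAt x hU).mul
    ((hasDerivAt_Phi_neg (V x)).comp_hasFDerivAt x hV)
  have h2 := ((hasDerivAt_Psi (U x)).comp_hasFDerivAt x hU).mul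
    ((hasDerivAt_Phi (V x)).comp_hasFDerivAt x hV)
  refine (h1.sub h2).congr_fderiv ?_
  ext e
  simp only [Function.comp_apply, lamU, lamV, dPhi_neg, _root_.sub_apply,
    _root_.add_apply, _root_.smul_apply, smul_eq_mul]
  ring

section

/-! ### The smooth part and its gradient -/

/-- The coordinates of `z` numbered from `1`, preceded by the constant `1`. -/
def chainExt {dbar : ℕ} (z : Fin dbar → ℝ) (k : ℕ) : ℝ := if k = 0 then 1 else coord z k

theorem chainExt_succ {dbar : ℕ} (z : Fin dbar → ℝ) (k : Fin dbar) :
    chainExt z (k + 1) = z k := by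
  have : (k : ℕ) + 1 ≤ dbar := k.2
  simp [chainExt, coord, this]

theorem chainExt_of_lt {dbar : ℕ} (z : Fin dbar → ℝ) {k : ℕ} (h : dbar < k) :
    chainExt z k = 0 := by
  have h0 : k ≠ 0 := by omega
  have h1 : ¬ (1 ≤ k ∧ k ≤ dbar) := by omega
  rw [chainExt, if_neg h0, coord, dif_neg h1]

/-- Since `Psi (-1) = 0`, the exceptional first link is an ordinary link whose predecessor is the
constant `1`. -/
theorem link_eq_lam {dbar : ℕ} (z : Fin dbar → ℝ) (j : ℕ) :
    link z (j + 1) = lam (chainExt z j) (chainExt z (j + 1)) := by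
  rcases j with _ | j
  · simp [link, lam, chainExt, Psi_of_nonpos (by norm_num : (-1 : ℝ) ≤ 0)]
  · simp [link, lam, chainExt]

/-- The weight of the `j`-th link in the `i`-th of `3q` blocks; zero beyond the last link. -/
def weight (q dbar i j : ℕ) : ℝ :=
  if j = 1 then 1
  else if j ≤ dbar ∧ ((i < q ∧ Even j) ∨ (2 * q ≤ i ∧ Odd j)) then 3 else 0

theorem weight_nonneg (q dbar i j : ℕ) : 0 ≤ weight q dbar i j := by
  unfold weight; split_ifs <;> norm_num

theorem weight_le (q dbar i j : ℕ) : weight q dbar i j ≤ 3 := by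
  unfold weight; split_ifs <;> norm_num

/-- The factor `3` compensates for a link being present in only one third of the blocks; the first
link has weight `1` in all of them. -/
theorem sum_weight {N q : ℕ} (hN : N = 3 * q) (dbar j : ℕ) (hj : 1 ≤ j) :
    ∑ i : Fin N, weight q dbar i j = if j = 1 ∨ j ≤ dbar then (N : ℝ) else 0 := by
  subst hN
  rcases eq_or_ne j 1 with rfl | h1
  · simp [weight]
  rw [Fin.sum_univ_eq_sum_range (fun i => weight q dbar i j) (3 * q)]
  by_cases hjd : j ≤ dbar
  · have e : 3 * q = q + (q + q) := by ring
    rw [e, Finset.sum_range_add, Finset.sum_range_add]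
    rcases Nat.even_or_odd j with hj | hj
    · have ho : ¬ Odd j := Nat.not_odd_iff_even.2 hj
      have s1 : ∑ i ∈ Finset.range q, weight q dbar i j = ∑ i ∈ Finset.range q, (3 : ℝ) :=
        Finset.sum_congr rfl fun i hi => by
          have := Finset.mem_range.1 hi
          simp [weight, h1, hjd, hj, this]
      have s2 : ∑ i ∈ Finset.range q, weight q dbar (q + i) j = 0 :=
        Finset.sum_eq_zero fun i hi => by simp [weight, h1, ho]
      have s3 : ∑ i ∈ Finset.range q, weight q dbar (q + (q + i)) j = 0 :=
        Finset.sum_eq_zero fun i hi => by simp [weight, h1, ho]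
      rw [s1, s2, s3]
      simp [hjd]; ring
    · have ho : ¬ Even j := Nat.not_even_iff_odd.2 hj
      have s1 : ∑ i ∈ Finset.range q, weight q dbar i j = 0 :=
        Finset.sum_eq_zero fun i hi => by
          have : ¬ 2 * q ≤ i := by have := Finset.mem_range.1 hi; omega
          simp [weight, h1, ho, this]
      have s2 : ∑ i ∈ Finset.range q, weight q dbar (q + i) j = 0 :=
        Finset.sum_eq_zero fun i hi => by
          have : ¬ 2 * q ≤ q + i := by have := Finset.mem_range.1 hi; omega
          simp [weight, h1, ho, this]
      have s3 : ∑ i ∈ Finset.range q, weight q dbar (q + (q + i)) j =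
          ∑ i ∈ Finset.range q, (3 : ℝ) :=
        Finset.sum_congr rfl fun i hi => by
          have : 2 * q ≤ q + (q + i) := by omega
          simp [weight, h1, hjd, hj, this]
      rw [s1, s2, s3]
      simp [hjd]; ring
  · simp [weight, h1, hjd]

theorem sum_range_odd (F : ℕ → ℝ) (n : ℕ) :
    ∑ j ∈ Finset.range (2 * n + 1), F (j + 1) =
      F 1 + ∑ j ∈ Finset.Icc 1 n, (F (2 * j) + F (2 * j + 1)) := by
  induction n with
  | zero => simp
  | succ n ih =>
    rw [show 2 * (n + 1) + 1 = 2 * n + 1 + 1 + 1 by ring, Finset.sum_range_succ,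
      Finset.sum_range_succ, ih, Finset.sum_Icc_succ_top (by omega)]
    rw [show 2 * (n + 1) = 2 * n + 1 + 1 by ring]
    ring

/-- The sum runs one link too far, with weight zero there, so that every coordinate, the last
included, has both an incoming and an outgoing link. Oddness of `dbar` lets the even and odd links
exhaust `2, …, dbar`. -/
theorem blockH_eq_sum {q dbar : ℕ} (hd : Odd dbar) (i : ℕ) (z : Fin dbar → ℝ) :
    blockH q i z = ∑ j ∈ Finset.range (dbar + 1),
      weight q dbar i (j + 1) * lam (chainExt z j) (chainExt z (j + 1)) := by
  obtain ⟨n, hn⟩ := hd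
  have hlast : weight q dbar i (dbar + 1) = 0 := by
    have : dbar ≠ 0 := by omega
    simp [weight, this]
  rw [Finset.sum_range_succ, hlast, zero_mul, add_zero]
  simp only [← link_eq_lam]
  have hr : ∑ j ∈ Finset.range dbar, weight q dbar i (j + 1) * link z (j + 1) =
      weight q dbar i 1 * link z 1 + ∑ j ∈ Finset.Icc 1 n,
        (weight q dbar i (2 * j) * link z (2 * j) +
          weight q dbar i (2 * j + 1) * link z (2 * j + 1)) := by
    rw [← sum_range_odd (fun j => weight q dbar i j * link z j), ← hn]
  have hn2 : dbar / 2 = n := by omega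
  have h1 : weight q dbar i 1 = 1 := by simp [weight]
  rw [hr, h1, one_mul]
  unfold blockH
  rw [hn2]
  have hev : ∀ j ∈ Finset.Icc 1 n, weight q dbar i (2 * j) = if i < q then 3 else 0 := by
    intro j hj
    rw [Finset.mem_Icc] at hj
    have a1 : 2 * j ≠ 1 := by omega
    have a2 : 2 * j ≤ dbar := by omega
    have a3 : ¬ Odd (2 * j) := by simp
    simp [weight, a1, a2, a3]
  have hodd : ∀ j ∈ Finset.Icc 1 n,
      weight q dbar i (2 * j + 1) = if 2 * q ≤ i then 3 else 0 := by
    intro j hj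
    rw [Finset.mem_Icc] at hj
    have a1 : j ≠ 0 := by omega
    have a2 : 2 * j + 1 ≤ dbar := by omega
    have a3 : ¬ Even (2 * j + 1) := by simp
    simp [weight, a1, a2, a3]
  have hs : ∑ j ∈ Finset.Icc 1 n, (weight q dbar i (2 * j) * link z (2 * j) +
      weight q dbar i (2 * j + 1) * link z (2 * j + 1)) =
      (if i < q then 3 else 0) * ∑ j ∈ Finset.Icc 1 n, link z (2 * j) +
      (if 2 * q ≤ i then 3 else 0) * ∑ j ∈ Finset.Icc 1 n, link z (2 * j + 1) := by
    rw [Finset.mul_sum, Finset.mul_sum, ← Finset.sum_add_distrib]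
    exact Finset.sum_congr rfl fun j hj => by rw [hev j hj, hodd j hj]
  rw [hs]
  by_cases c1 : i < q
  · have c2 : ¬ 2 * q ≤ i := by omega
    simp [c1, c2]
  · by_cases c2 : i < 2 * q
    · simp [c1, c2]
    · simp [c1, c2, not_lt.1 c2]

/-- The `k`-th partial derivative of `h_i`, as a function of the extended chain `y`. -/
def chainDeriv (q dbar i : ℕ) (y : ℕ → ℝ) (k : ℕ) : ℝ :=
  weight q dbar i k * lamV (y (k - 1)) (y k) + weight q dbar i (k + 1) * lamU (y k) (y (k + 1))

theorem abs_chainDeriv_le (q dbar i : ℕ) (y : ℕ → ℝ) (k : ℕ) :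
    |chainDeriv q dbar i y k| ≤ 12 + 12 * Real.pi := by
  unfold chainDeriv
  refine (abs_add_le _ _).trans ?_
  rw [abs_mul, abs_mul, abs_of_nonneg (weight_nonneg _ _ _ _),
    abs_of_nonneg (weight_nonneg _ _ _ _)]
  have h1 := mul_le_mul (weight_le q dbar i k) (abs_lamV_le (y (k - 1)) (y k))
    (abs_nonneg _) (by norm_num)
  have h2 := mul_le_mul (weight_le q dbar i (k + 1)) (abs_lamU_le (y k) (y (k + 1)))
    (abs_nonneg _) (by norm_num)
  linarith

theorem abs_chainDeriv_sub_le (q dbar i : ℕ) (y y' : ℕ → ℝ) (k : ℕ) :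
    |chainDeriv q dbar i y k - chainDeriv q dbar i y' k| ≤
      12 * |y (k - 1) - y' (k - 1)| + (9 + 48 * Real.pi) * |y k - y' k| +
        24 * |y (k + 1) - y' (k + 1)| := by
  have e : chainDeriv q dbar i y k - chainDeriv q dbar i y' k =
    weight q dbar i k * (lamV (y (k - 1)) (y k) - lamV (y' (k - 1)) (y' k)) +
      weight q dbar i (k + 1) * (lamU (y k) (y (k + 1)) - lamU (y' k) (y' (k + 1))) := by
    unfold chainDeriv; ring
  rw [e]
  refine (abs_add_le _ _).trans ?_
  rw [abs_mul, abs_mul, abs_of_nonneg (weight_nonneg _ _ _ _),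
    abs_of_nonneg (weight_nonneg _ _ _ _)]
  have h1 := mul_le_mul (weight_le q dbar i k) (abs_lamV_sub_le (y (k - 1)) (y k)
    (y' (k - 1)) (y' k)) (abs_nonneg _) (by norm_num)
  have h2 := mul_le_mul (weight_le q dbar i (k + 1)) (abs_lamU_sub_le (y k) (y (k + 1))
    (y' k) (y' (k + 1))) (abs_nonneg _) (by norm_num)
  linarith

variable {N dbar : ℕ}

/-- The rescaled chain of the `i`-th block. -/
def blockChain (a : ℝ) (x : EuclideanSpace ℝ (Fin N × Fin dbar)) (i : Fin N) : ℕ → ℝ :=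
  chainExt fun j => a * x (i, j)

/-- The function `∑ c h_i(a x_i)`. -/
def smoothPart (q : ℕ) (c a : ℝ) (x : EuclideanSpace ℝ (Fin N × Fin dbar)) : ℝ :=
  ∑ i : Fin N, c * ∑ j ∈ Finset.range (dbar + 1),
    weight q dbar i (j + 1) * lam (blockChain a x i j) (blockChain a x i (j + 1))

/-- The derivative of `x ↦ blockChain a x i k`. -/
def blockChainDeriv (a : ℝ) (i : Fin N) (k : ℕ) :
    EuclideanSpace ℝ (Fin N × Fin dbar) →L[ℝ] ℝ :=
  if h : 1 ≤ k ∧ k ≤ dbar then a • EuclideanSpace.proj (i, ⟨k - 1, by omega⟩) else 0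

theorem hasFDerivAt_blockChain (a : ℝ) (i : Fin N) (k : ℕ)
    (x : EuclideanSpace ℝ (Fin N × Fin dbar)) :
    HasFDerivAt (fun x => blockChain a x i k) (blockChainDeriv a i k) x := by
  unfold blockChainDeriv
  split_ifs with h
  · have e : (fun x : EuclideanSpace ℝ (Fin N × Fin dbar) => blockChain a x i k) =
        fun x => a * x (i, ⟨k - 1, by omega⟩) := by
      funext x
      have h0 : k ≠ 0 := by omega
      simp [blockChain, chainExt, coord, h, h0]
    rw [e]
    exact ((EuclideanSpace.proj (𝕜 := ℝ) (i, (⟨k - 1, by omega⟩ : Fin dbar))).hasFDerivAt).const_mul a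
  · have e : (fun x : EuclideanSpace ℝ (Fin N × Fin dbar) => blockChain a x i k) =
        fun _ => if k = 0 then 1 else 0 := by
      funext x
      simp [blockChain, chainExt, coord, h]
    rw [e]
    exact hasFDerivAt_const _ _

theorem blockChainDeriv_single (a : ℝ) (i i' : Fin N) (k : ℕ) (k' : Fin dbar) :
    blockChainDeriv a i k (EuclideanSpace.single (i', k') 1) =
      if i = i' ∧ k = k' + 1 then a else 0 := by
  unfold blockChainDeriv
  have := k'.2
  split_ifs with h1 h2 h2
  · obtain ⟨rfl, rfl⟩ := h2
    simp
  · have : (i, (⟨k - 1, by omega⟩ : Fin dbar)) ≠ (i', k') := by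
      rintro h
      obtain ⟨hi, hk⟩ := Prod.mk.inj h
      have hk := Fin.ext_iff.1 hk
      exact h2 ⟨hi, by simp only at hk; omega⟩
    simp [this]
  · omega
  · rfl

theorem hasFDerivAt_smoothPart (q : ℕ) (c a : ℝ) (x : EuclideanSpace ℝ (Fin N × Fin dbar)) :
    HasFDerivAt (smoothPart q c a)
      (∑ i : Fin N, c • ∑ j ∈ Finset.range (dbar + 1), weight q dbar i (j + 1) •
        (lamU (blockChain a x i j) (blockChain a x i (j + 1)) • blockChainDeriv a i j +
          lamV (blockChain a x i j) (blockChain a x i (j + 1)) • blockChainDeriv a i (j + 1))) x := by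
  unfold smoothPart
  refine HasFDerivAt.fun_sum fun i _ => HasFDerivAt.const_mul ?_ c
  refine HasFDerivAt.fun_sum fun j _ => HasFDerivAt.const_mul ?_ _
  exact HasFDerivAt.lam (hasFDerivAt_blockChain a i j x) (hasFDerivAt_blockChain a i (j + 1) x)

theorem gradient_apply {ι : Type*} [Fintype ι] [DecidableEq ι] {f : EuclideanSpace ℝ ι → ℝ}
    {f' : EuclideanSpace ℝ ι →L[ℝ] ℝ} {x : EuclideanSpace ℝ ι} (h : HasFDerivAt f f' x) (p : ι) :
    gradient f x p = f' (EuclideanSpace.single p 1) := by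
  have h1 : inner ℝ (gradient f x) (EuclideanSpace.single p (1 : ℝ)) =
      f' (EuclideanSpace.single p 1) := by
    rw [gradient, InnerProductSpace.toDual_symm_apply, h.fderiv]
  rw [← h1, EuclideanSpace.inner_single_right]
  simp

theorem gradient_smoothPart (q : ℕ) (c a : ℝ) (x : EuclideanSpace ℝ (Fin N × Fin dbar))
    (i : Fin N) (k : Fin dbar) :
    gradient (smoothPart q c a) x (i, k) =
      c * a * chainDeriv q dbar i (blockChain a x i) (k + 1) := by
  rw [gradient_apply (hasFDerivAt_smoothPart q c a x)]
  simp only [_root_.sum_apply, _root_.smul_apply, _root_.add_apply, smul_eq_mul,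
    blockChainDeriv_single]
  rw [Finset.sum_eq_single i (by
    intro i' _ hi'
    simp [hi']) (by simp)]
  simp only [true_and, mul_add, Finset.sum_add_distrib]
  simp only [add_left_inj, mul_ite, mul_zero, Finset.sum_ite_eq', Finset.mem_range]
  have hk := k.2
  rw [if_pos (by omega), if_pos (by omega)]
  unfold chainDeriv
  simp only [add_tsub_cancel_right]
  ring

end

section

/-! ### Lipschitz gradient and lower bound of the smooth part -/

/-- A tridiagonal operator with constant bands has norm at most the sum of the bands: convexity of
the square bounds each term, and the zero boundary values make the shifted sums no larger than the
central one. -/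
theorem sum_tridiagonal_sq_le {p r s : ℝ} (hp : 0 ≤ p) (hr : 0 ≤ r) (hs : 0 ≤ s) (n : ℕ)
    (δ : ℕ → ℝ) (h0 : δ 0 = 0) (hn : δ (n + 1) = 0) :
    ∑ k ∈ Finset.range n, (p * |δ k| + r * |δ (k + 1)| + s * |δ (k + 2)|) ^ 2 ≤
      (p + r + s) ^ 2 * ∑ k ∈ Finset.range n, δ (k + 1) ^ 2 := by
  have h1 : ∑ k ∈ Finset.range n, δ k ^ 2 ≤ ∑ k ∈ Finset.range n, δ (k + 1) ^ 2 := by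
    have e1 := Finset.sum_range_succ (fun k => δ k ^ 2) n
    have e2 := Finset.sum_range_succ' (fun k => δ k ^ 2) n
    rw [h0] at e2
    nlinarith [sq_nonneg (δ n)]
  have h2 : ∑ k ∈ Finset.range n, δ (k + 2) ^ 2 ≤ ∑ k ∈ Finset.range n, δ (k + 1) ^ 2 := by
    have e1 := Finset.sum_range_succ (fun k => δ (k + 1) ^ 2) n
    have e2 := Finset.sum_range_succ' (fun k => δ (k + 1) ^ 2) n
    rw [hn] at e1
    simp only [zero_add, add_assoc, Nat.reduceAdd] at e1 e2
    nlinarith [sq_nonneg (δ 1)]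
  have h3 : ∀ k ∈ Finset.range n, (p * |δ k| + r * |δ (k + 1)| + s * |δ (k + 2)|) ^ 2 ≤
      (p + r + s) * (p * δ k ^ 2 + r * δ (k + 1) ^ 2 + s * δ (k + 2) ^ 2) := by
    intro k _
    rw [← sq_abs (δ k), ← sq_abs (δ (k + 1)), ← sq_abs (δ (k + 2))]
    have i1 := mul_nonneg (mul_nonneg hp hr) (sq_nonneg (|δ k| - |δ (k + 1)|))
    have i2 := mul_nonneg (mul_nonneg hp hs) (sq_nonneg (|δ k| - |δ (k + 2)|))
    have i3 := mul_nonneg (mul_nonneg hr hs) (sq_nonneg (|δ (k + 1)| - |δ (k + 2)|))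
    nlinarith
  refine (Finset.sum_le_sum h3).trans ?_
  rw [← Finset.mul_sum, Finset.sum_add_distrib, Finset.sum_add_distrib, ← Finset.mul_sum,
    ← Finset.mul_sum, ← Finset.mul_sum, sq, mul_assoc]
  refine mul_le_mul_of_nonneg_left ?_ (by positivity)
  nlinarith [mul_le_mul_of_nonneg_left h1 hp, mul_le_mul_of_nonneg_left h2 hs]

variable {N dbar : ℕ}

theorem blockChain_zero (a : ℝ) (x : EuclideanSpace ℝ (Fin N × Fin dbar)) (i : Fin N) :
    blockChain a x i 0 = 1 := rfl

theorem blockChain_succ (a : ℝ) (x : EuclideanSpace ℝ (Fin N × Fin dbar)) (i : Fin N)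
    (k : Fin dbar) : blockChain a x i (k + 1) = a * x (i, k) := chainExt_succ _ k

theorem blockChain_of_lt (a : ℝ) (x : EuclideanSpace ℝ (Fin N × Fin dbar)) (i : Fin N)
    {k : ℕ} (h : dbar < k) : blockChain a x i k = 0 := chainExt_of_lt _ h

theorem norm_gradient_smoothPart_sub_le (q : ℕ) {c a : ℝ} (hc : 0 ≤ c) (ha : 0 ≤ a)
    (x x' : EuclideanSpace ℝ (Fin N × Fin dbar)) :
    ‖gradient (smoothPart q c a) x - gradient (smoothPart q c a) x'‖ ≤
      c * a * a * (75 * Real.pi) * ‖x - x'‖ := by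
  have hblock : ∀ i : Fin N, ∑ k : Fin dbar,
      (chainDeriv q dbar i (blockChain a x i) (k + 1) -
        chainDeriv q dbar i (blockChain a x' i) (k + 1)) ^ 2 ≤
      (75 * Real.pi) ^ 2 * ∑ k : Fin dbar, (a * (x (i, k) - x' (i, k))) ^ 2 := by
    intro i
    set δ : ℕ → ℝ := fun k => blockChain a x i k - blockChain a x' i k with hδ
    have e : ∑ k : Fin dbar, (a * (x (i, k) - x' (i, k))) ^ 2 =
        ∑ k ∈ Finset.range dbar, δ (k + 1) ^ 2 := by
      rw [← Fin.sum_univ_eq_sum_range (fun k => δ (k + 1) ^ 2)]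
      refine Finset.sum_congr rfl fun k _ => ?_
      rw [hδ]
      simp only [blockChain_succ]
      ring
    rw [e, Fin.sum_univ_eq_sum_range (fun k => (chainDeriv q dbar i (blockChain a x i) (k + 1) -
        chainDeriv q dbar i (blockChain a x' i) (k + 1)) ^ 2)]
    have hπ := Real.pi_gt_three
    -- The bands come from `abs_chainDeriv_sub_le`; their sum `45 + 48π` is below `75π`. The
    -- constant predecessor and the zero tail make the differences vanish at both ends.
    have h := sum_tridiagonal_sq_le (p := 12) (r := 9 + 48 * Real.pi) (s := 24) (by norm_num)
      (by positivity) (by norm_num) dbar δ (by simp [hδ, blockChain_zero])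
      (by simp [hδ, blockChain_of_lt])
    refine (Finset.sum_le_sum fun k _ => ?_).trans (h.trans ?_)
    · rw [← sq_abs]
      gcongr
      exact abs_chainDeriv_sub_le q dbar i _ _ (k + 1)
    · refine mul_le_mul_of_nonneg_right ?_ (Finset.sum_nonneg fun _ _ => sq_nonneg _)
      gcongr
      linarith
  have hsq : ‖gradient (smoothPart q c a) x - gradient (smoothPart q c a) x'‖ ^ 2 ≤
      (c * a * a * (75 * Real.pi) * ‖x - x'‖) ^ 2 := by
    rw [mul_pow, EuclideanSpace.real_norm_sq_eq, EuclideanSpace.real_norm_sq_eq,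
      Fintype.sum_prod_type, Fintype.sum_prod_type, Finset.mul_sum]
    refine Finset.sum_le_sum fun i _ => ?_
    simp only [PiLp.sub_apply, gradient_smoothPart, ← mul_sub]
    have h := mul_le_mul_of_nonneg_left (hblock i) (sq_nonneg (c * a))
    simp only [mul_pow, ← Finset.mul_sum] at h ⊢
    linarith
  exact abs_le_of_sq_le_sq' hsq (by positivity) |>.2

/-- Each link is at least `-4π`, and each of the `dbar` links has total weight `N`. -/
theorem neg_le_smoothPart {q : ℕ} (hN : N = 3 * q) {c : ℝ} (hc : 0 ≤ c) (a : ℝ) (hd : 1 ≤ dbar)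
    (x : EuclideanSpace ℝ (Fin N × Fin dbar)) :
    -(c * (N * dbar * (4 * Real.pi))) ≤ smoothPart q c a x := by
  unfold smoothPart
  rw [← Finset.mul_sum, ← mul_neg]
  refine mul_le_mul_of_nonneg_left ?_ hc
  rw [Finset.sum_comm]
  have h1 : ∀ j ∈ Finset.range (dbar + 1), (if j < dbar then -((N : ℝ) * (4 * Real.pi)) else 0) ≤
      ∑ i : Fin N, weight q dbar i (j + 1) *
        lam (blockChain a x i j) (blockChain a x i (j + 1)) := by
    intro j _
    have h2 : ∑ i : Fin N, weight q dbar i (j + 1) * (-(4 * Real.pi)) ≤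
        ∑ i : Fin N, weight q dbar i (j + 1) *
          lam (blockChain a x i j) (blockChain a x i (j + 1)) :=
      Finset.sum_le_sum fun i _ => mul_le_mul_of_nonneg_left (lam_ge _ _) (weight_nonneg _ _ _ _)
    refine le_trans ?_ h2
    rw [← Finset.sum_mul, sum_weight hN dbar (j + 1) (by omega)]
    by_cases hj : j < dbar
    · rw [if_pos hj, if_pos (Or.inr (Nat.succ_le_of_lt hj))]; linarith
    · rw [if_neg hj, if_neg (by omega)]; simp
  refine le_trans ?_ (Finset.sum_le_sum h1)
  rw [Finset.sum_range_succ, if_neg (lt_irrefl _), add_zero,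
    Finset.sum_congr rfl (fun j hj => if_pos (Finset.mem_range.1 hj)), Finset.sum_const,
    Finset.card_range, nsmul_eq_mul]
  linarith

theorem smoothPart_zero_nonpos (q : ℕ) {c : ℝ} (hc : 0 ≤ c) (a : ℝ) :
    smoothPart q c a (0 : EuclideanSpace ℝ (Fin N × Fin dbar)) ≤ 0 := by
  unfold smoothPart
  refine Finset.sum_nonpos fun i _ => mul_nonpos_of_nonneg_of_nonpos hc ?_
  have hz : ∀ k : ℕ, blockChain a (0 : EuclideanSpace ℝ (Fin N × Fin dbar)) i (k + 1) = 0 := by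
    intro k
    rcases lt_or_ge k dbar with h | h
    · simpa using blockChain_succ a (0 : EuclideanSpace ℝ (Fin N × Fin dbar)) i ⟨k, h⟩
    · exact blockChain_of_lt _ _ _ (by omega)
  refine Finset.sum_nonpos fun j _ => mul_nonpos_of_nonneg_of_nonpos (weight_nonneg _ _ _ _) ?_
  rcases j with _ | j
  · rw [blockChain_zero, hz]; exact lam_one_zero_nonpos
  · rw [hz, lam_zero_left]

/-! ### Difference matrices -/

/-- The block before the `r`-th difference. -/
def lo (r : Fin (N - 1)) : Fin N := ⟨r, by omega⟩

/-- The block after the `r`-th difference. -/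
def hi (r : Fin (N - 1)) : Fin N := ⟨r + 1, by omega⟩

theorem J_mulVec (y : Fin N → ℝ) (r : Fin (N - 1)) :
    ∑ i, J N r i * y i = y (hi r) - y (lo r) := by
  have e : ∀ i, J N r i * y i = (if i = hi r then y i else 0) - (if i = lo r then y i else 0) := by
    intro i
    have h1 : i = hi r ↔ (i : ℕ) = r + 1 := Fin.ext_iff
    have h2 : i = lo r ↔ (i : ℕ) = r := Fin.ext_iff
    simp only [J, Matrix.of_apply, h1, h2]
    by_cases c1 : (i : ℕ) = r
    · simp [c1]
    · by_cases c2 : (i : ℕ) = r + 1 <;> simp [c1, c2]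
  simp [Finset.sum_congr rfl (fun i _ => e i)]

theorem diff_mulVec (s : ℝ) (p : Fin (N - 1) → Prop)
    (x : EuclideanSpace ℝ (Fin N × Fin dbar)) (r : {r // p r}) (k : Fin dbar) :
    (s • ((J N).submatrix (Subtype.val : {r // p r} → _) id ⊗ₖ
      (1 : Matrix (Fin dbar) (Fin dbar) ℝ))).mulVec x (r, k) =
      s * (x (hi r.1, k) - x (lo r.1, k)) := by
  rw [Matrix.smul_mulVec, Pi.smul_apply, smul_eq_mul, ← J_mulVec (fun i => x (i, k))]
  congr 1
  simp only [Matrix.mulVec, dotProduct, Fintype.sum_prod_type, Matrix.kroneckerMap_apply,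
    Matrix.submatrix_apply, id, Matrix.one_apply]
  simp

theorem hardA_apply (m₁ m₂ : ℕ) (L : ℝ)
    (x : EuclideanSpace ℝ (Fin (3 * m₁ * m₂) × Fin dbar)) (r : RowMc m₁ m₂) (k : Fin dbar) :
    Matrix.toEuclideanLin (hardA m₁ m₂ dbar L) x (r, k) =
      ((3 * m₁ * m₂ : ℕ) : ℝ) * L * (x (hi r.1, k) - x (lo r.1, k)) :=
  diff_mulVec _ _ x r k

theorem hardAbar_apply (m₁ m₂ : ℕ) (L : ℝ)
    (x : EuclideanSpace ℝ (Fin (3 * m₁ * m₂) × Fin dbar)) (r : RowM m₁ m₂) (k : Fin dbar) :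
    Matrix.toEuclideanLin (hardAbar m₁ m₂ dbar L) x (r, k) =
      ((3 * m₁ * m₂ : ℕ) : ℝ) * L * (x (hi r.1, k) - x (lo r.1, k)) :=
  diff_mulVec _ _ x r k

/-! ### Condition number of the stacked difference matrix -/

theorem inner_toEuclideanLin_transpose {κ ι : Type*} [Fintype κ] [Fintype ι] [DecidableEq κ]
    [DecidableEq ι] (M : Matrix κ ι ℝ) (γ : EuclideanSpace ℝ κ) (x : EuclideanSpace ℝ ι) :
    inner ℝ (Matrix.toEuclideanLin M.transpose γ) x = inner ℝ γ (Matrix.toEuclideanLin M x) := by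
  rw [← Matrix.conjTranspose_eq_transpose_of_trivial, Matrix.toEuclideanLin_conjTranspose_eq_adjoint,
    LinearMap.adjoint_inner_left]

/-- If `‖M x‖ ≤ b ‖x‖`, and every vector is of the form `M x` with `a ‖x‖ ≤ ‖M x‖`, then the
condition number of `M` is at most `b / a`. -/
theorem condNumber_le {κ ι : Type*} [Fintype κ] [Fintype ι] [DecidableEq κ] [DecidableEq ι]
    (M : Matrix κ ι ℝ) {a b : ℝ} (ha : 0 < a) (hb : 0 ≤ b)
    (hupper : ∀ x, ‖Matrix.toEuclideanLin M x‖ ≤ b * ‖x‖)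
    (hlower : ∀ v, ∃ x, Matrix.toEuclideanLin M x = v ∧ a * ‖x‖ ≤ ‖v‖) :
    condNumber M ≤ b / a := by
  have key : ∀ μ : ℝ, Module.End.HasEigenvalue (Matrix.toLin' (M * M.transpose)) μ →
      a ^ 2 ≤ μ ∧ μ ≤ b ^ 2 := by
    intro μ hμ
    obtain ⟨v', hv'⟩ := hμ.exists_hasEigenvector
    have hv1 := hv'.apply_eq_smul
    have hv2 := hv'.2
    set v : EuclideanSpace ℝ κ := WithLp.toLp 2 v' with hv
    have hvne : v ≠ 0 := by
      intro h
      apply hv2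
      have := congrArg WithLp.ofLp h
      simpa [hv] using this
    have hvpos : 0 < ‖v‖ := norm_pos_iff.2 hvne
    set w := Matrix.toEuclideanLin M.transpose v with hw
    have hMw : Matrix.toEuclideanLin M w = μ • v := by
      have : (M * M.transpose).mulVec v' = μ • v' := by simpa using hv1
      ext i
      have h2 := congrFun this i
      rw [← Matrix.mulVec_mulVec] at h2
      exact h2
    have hin : ‖w‖ ^ 2 = μ * ‖v‖ ^ 2 := by
      rw [← real_inner_self_eq_norm_sq, hw, inner_toEuclideanLin_transpose, ← hw, hMw,
        real_inner_smul_right, real_inner_self_eq_norm_sq]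
    constructor
    · obtain ⟨x, hx1, hx2⟩ := hlower v
      -- With `v = M x` and `w = Mᵀ v`, `‖v‖² = ⟨v, M x⟩ = ⟨w, x⟩`, so the bounded preimage `x`
      -- forces `w` to be large.
      have h1 : ‖v‖ ^ 2 ≤ ‖w‖ * ‖x‖ := by
        rw [← real_inner_self_eq_norm_sq]
        nth_rewrite 2 [← hx1]
        rw [← inner_toEuclideanLin_transpose]
        exact real_inner_le_norm _ _
      have h2 : a * ‖v‖ ≤ ‖w‖ := by
        have : a * ‖v‖ * ‖v‖ ≤ ‖w‖ * ‖v‖ := by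
          nlinarith [mul_le_mul_of_nonneg_left h1 ha.le,
            mul_le_mul_of_nonneg_left hx2 (norm_nonneg w)]
        exact le_of_mul_le_mul_right this hvpos
      have h3 : (a * ‖v‖) ^ 2 ≤ ‖w‖ ^ 2 := by gcongr
      rw [hin, mul_pow] at h3
      exact le_of_mul_le_mul_right h3 (by positivity)
    · have h1 : ‖w‖ ^ 2 ≤ ‖v‖ * (b * ‖w‖) := by
        rw [← real_inner_self_eq_norm_sq]
        nth_rewrite 1 [hw]
        rw [inner_toEuclideanLin_transpose]
        exact (real_inner_le_norm _ _).trans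
          (mul_le_mul_of_nonneg_left (hupper w) (norm_nonneg _))
      have h2 : ‖w‖ ≤ b * ‖v‖ := by
        rcases (norm_nonneg w).eq_or_lt with h | h
        · rw [← h]; positivity
        · refine le_of_mul_le_mul_right ?_ h
          nlinarith
      have h3 : ‖w‖ ^ 2 ≤ (b * ‖v‖) ^ 2 := by gcongr
      rw [hin, mul_pow] at h3
      exact le_of_mul_le_mul_right h3 (by positivity)
  unfold condNumber
  rw [Real.sqrt_le_left (by positivity), div_pow]
  set S := {μ : ℝ | 0 < μ ∧ Module.End.HasEigenvalue (Matrix.toLin' (M * M.transpose)) μ}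
  have hsup : sSup {μ : ℝ | Module.End.HasEigenvalue (Matrix.toLin' (M * M.transpose)) μ} ≤
      b ^ 2 := Real.sSup_le (fun μ hμ => (key μ hμ).2) (by positivity)
  -- Without positive eigenvalues the infimum is `0` by convention, and so is the quotient.
  rcases S.eq_empty_or_nonempty with hS | hS
  · rw [hS, Real.sInf_empty, div_zero]; positivity
  · have hinf : a ^ 2 ≤ sInf S := le_csInf hS fun μ hμ => (key μ hμ.2).1
    exact div_le_div₀ (by positivity) hsup (by positivity) hinf

theorem sum_sub_sq_le (y : Fin N → ℝ) :
    ∑ r : Fin (N - 1), (y (hi r) - y (lo r)) ^ 2 ≤ 4 * ∑ i, y i ^ 2 := by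
  rcases N with _ | n
  · simp
  have h1 : ∑ r : Fin n, y r.succ ^ 2 ≤ ∑ i, y i ^ 2 := by
    rw [Fin.sum_univ_succ]; nlinarith [sq_nonneg (y 0)]
  have h2 : ∑ r : Fin n, y r.castSucc ^ 2 ≤ ∑ i, y i ^ 2 := by
    rw [Fin.sum_univ_castSucc]; nlinarith [sq_nonneg (y (Fin.last n))]
  have h3 : ∑ r : Fin n, (y r.succ - y r.castSucc) ^ 2 ≤
      ∑ r : Fin n, (2 * y r.succ ^ 2 + 2 * y r.castSucc ^ 2) :=
    Finset.sum_le_sum fun r _ => by nlinarith [sq_nonneg (y r.succ + y r.castSucc)]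
  rw [Finset.sum_add_distrib, ← Finset.mul_sum, ← Finset.mul_sum] at h3
  have h4 : ∑ r : Fin (n + 1 - 1), (y (hi r) - y (lo r)) ^ 2 =
      ∑ r : Fin n, (y r.succ - y r.castSucc) ^ 2 := rfl
  linarith

/-- Every vector of differences is attained by a vector of comparable size. -/
theorem exists_differences (y : Fin (N - 1) → ℝ) :
    ∃ z : Fin N → ℝ, (∀ r, z (hi r) - z (lo r) = y r) ∧
      ∑ i, z i ^ 2 ≤ (N : ℝ) ^ 2 * ∑ r, y r ^ 2 := by
  set Y : ℕ → ℝ := fun n => if h : n < N - 1 then y ⟨n, h⟩ else 0 with hY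
  have hYy : ∑ r ∈ Finset.range (N - 1), Y r ^ 2 = ∑ r, y r ^ 2 := by
    rw [← Fin.sum_univ_eq_sum_range (fun n => Y n ^ 2)]
    exact Finset.sum_congr rfl fun r _ => by simp [hY]
  -- Partial sums have the prescribed differences; Cauchy–Schwarz gives one factor `N` for each
  -- entry and the number of entries gives the other.
  refine ⟨fun i => ∑ n ∈ Finset.range i, Y n, fun r => ?_, ?_⟩
  · simp [hi, lo, Finset.sum_range_succ, hY]
  · have h1 : ∀ i : Fin N, (∑ n ∈ Finset.range i, Y n) ^ 2 ≤ (N : ℝ) * ∑ r, y r ^ 2 := by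
      intro i
      have h2 := sq_sum_le_card_mul_sum_sq (s := Finset.range (i : ℕ)) (f := Y)
      rw [Finset.card_range] at h2
      refine h2.trans (mul_le_mul ?_ ?_ (Finset.sum_nonneg fun _ _ => sq_nonneg _) (by positivity))
      · exact_mod_cast i.2.le
      · rw [← hYy]
        refine Finset.sum_le_sum_of_subset_of_nonneg ?_ fun _ _ _ => sq_nonneg _
        intro n hn
        rw [Finset.mem_range] at hn ⊢
        omega
    refine (Finset.sum_le_sum fun i _ => h1 i).trans ?_
    rw [Finset.sum_const, Finset.card_univ, Fintype.card_fin, nsmul_eq_mul]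
    linarith

/-- Together the rows of `Ā` and `A` are all rows of `s J ⊗ I` with `s = mL`. The upper bound is
`2s` (`sum_sub_sq_le`) and the preimage bound is `s / m` (`exists_differences`), both used
coordinate by coordinate. -/
theorem condNumber_hard_le (m₁ m₂ : ℕ) {L : ℝ} (hL : 0 < L) (hN : 0 < 3 * m₁ * m₂) :
    condNumber (Matrix.fromRows (hardAbar m₁ m₂ dbar L) (hardA m₁ m₂ dbar L)) ≤
      2 * ((3 * m₁ * m₂ : ℕ) : ℝ) := by
  set N := 3 * m₁ * m₂ with hNdef
  have hN' : (0 : ℝ) < (N : ℝ) := by exact_mod_cast hN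
  set s : ℝ := (N : ℝ) * L with hs
  have hs0 : 0 < s := mul_pos hN' hL
  set p : Fin (N - 1) → Prop := fun r => m₁ ∣ (r : ℕ) + 1 with hp
  have hinl : ∀ (x : EuclideanSpace ℝ (Fin N × Fin dbar)) (r : RowM m₁ m₂) (k : Fin dbar),
      Matrix.toEuclideanLin (Matrix.fromRows (hardAbar m₁ m₂ dbar L) (hardA m₁ m₂ dbar L)) x
        (Sum.inl (r, k)) = s * (x (hi r.1, k) - x (lo r.1, k)) :=
    fun x r k => hardAbar_apply m₁ m₂ L x r k
  have hinr : ∀ (x : EuclideanSpace ℝ (Fin N × Fin dbar)) (r : RowMc m₁ m₂) (k : Fin dbar),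
      Matrix.toEuclideanLin (Matrix.fromRows (hardAbar m₁ m₂ dbar L) (hardA m₁ m₂ dbar L)) x
        (Sum.inr (r, k)) = s * (x (hi r.1, k) - x (lo r.1, k)) :=
    fun x r k => hardA_apply m₁ m₂ L x r k
  have e : 2 * (N : ℝ) = (2 * s) / (s / N) := by field_simp
  rw [e]
  refine condNumber_le _ (by positivity) (by positivity) ?_ ?_
  · intro x
    have hsq : ‖Matrix.toEuclideanLin (Matrix.fromRows (hardAbar m₁ m₂ dbar L)
        (hardA m₁ m₂ dbar L)) x‖ ^ 2 ≤ (2 * s * ‖x‖) ^ 2 := by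
      rw [mul_pow, EuclideanSpace.real_norm_sq_eq, EuclideanSpace.real_norm_sq_eq,
        Fintype.sum_sum_type, Fintype.sum_prod_type, Fintype.sum_prod_type]
      simp only [hinl, hinr]
      rw [Fintype.sum_subtype_add_sum_subtype p
        (fun r => ∑ k : Fin dbar, (s * (x (hi r, k) - x (lo r, k))) ^ 2), Finset.sum_comm,
        Fintype.sum_prod_type_right, Finset.mul_sum]
      refine Finset.sum_le_sum fun k _ => ?_
      have := mul_le_mul_of_nonneg_left (sum_sub_sq_le fun i => x (i, k)) (sq_nonneg s)
      simp only [mul_pow, ← Finset.mul_sum]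
      linarith
    exact (abs_le_of_sq_le_sq' hsq (by positivity)).2
  · intro v
    set Y : Fin (N - 1) → Fin dbar → ℝ := fun r k =>
      if h : p r then v (Sum.inl (⟨r, h⟩, k)) else v (Sum.inr (⟨r, h⟩, k)) with hY
    choose z hz1 hz2 using fun k => exists_differences fun r => Y r k
    refine ⟨WithLp.toLp 2 fun ik => z ik.2 ik.1 / s, ?_, ?_⟩
    · ext rk
      rcases rk with ⟨r, k⟩ | ⟨r, k⟩
      · rw [hinl]
        simp only [← sub_div, hz1, hY]
        rw [dif_pos r.2]
        field_simp
      · rw [hinr]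
        simp only [← sub_div, hz1, hY]
        rw [dif_neg r.2]
        field_simp
    · have hsq : (s / N * ‖(WithLp.toLp 2 fun ik => z ik.2 ik.1 / s :
          EuclideanSpace ℝ (Fin N × Fin dbar))‖) ^ 2 ≤ ‖v‖ ^ 2 := by
        rw [mul_pow, EuclideanSpace.real_norm_sq_eq, EuclideanSpace.real_norm_sq_eq,
          Fintype.sum_sum_type, Fintype.sum_prod_type_right]
        have e1 : (∑ r : RowM m₁ m₂, ∑ k, v (Sum.inl (r, k)) ^ 2) +
            ∑ r : RowMc m₁ m₂, ∑ k, v (Sum.inr (r, k)) ^ 2 = ∑ r, ∑ k, Y r k ^ 2 := by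
          rw [← Fintype.sum_subtype_add_sum_subtype p (fun r => ∑ k : Fin dbar, Y r k ^ 2)]
          congr 1
          · exact Finset.sum_congr rfl fun r _ => Finset.sum_congr rfl fun k _ => by
              simp only [hY]; rw [dif_pos r.2]
          · exact Finset.sum_congr rfl fun r _ => Finset.sum_congr rfl fun k _ => by
              simp only [hY]; rw [dif_neg r.2]
        rw [Fintype.sum_prod_type, Fintype.sum_prod_type, e1,
          Finset.sum_comm (s := (Finset.univ : Finset (Fin (N - 1)))), Finset.mul_sum]
        refine Finset.sum_le_sum fun k _ => ?_
        simp only [div_pow, ← Finset.sum_div]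
        have h := hz2 k
        rw [div_mul_div_comm, div_le_iff₀ (by positivity)]
        nlinarith [mul_le_mul_of_nonneg_left h (sq_nonneg s)]
      exact (abs_le_of_sq_le_sq' hsq (norm_nonneg _)).2

end

section

/-! ### The data of the hard instance -/

/-- The factor `300 π ε² / (m L)` in front of the functions `h_i`. -/
def hardCoef (N : ℕ) (L ε : ℝ) : ℝ := 300 * Real.pi * ε ^ 2 / ((N : ℝ) * L)

/-- The scaling `√m L / (150 π ε)` inside the functions `h_i`. -/
def hardScale (N : ℕ) (L ε : ℝ) : ℝ := √(N : ℝ) * L / (150 * Real.pi * ε)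

section scaling

variable {N : ℕ} {L ε : ℝ}

theorem hardCoef_pos (hN : 0 < N) (hL : 0 < L) (hε : 0 < ε) : 0 < hardCoef N L ε := by
  unfold hardCoef; positivity

theorem hardScale_pos (hN : 0 < N) (hL : 0 < L) (hε : 0 < ε) : 0 < hardScale N L ε := by
  unfold hardScale; positivity

theorem hardCoef_mul_hardScale (hN : 0 < N) (hL : 0 < L) (hε : 0 < ε) :
    hardCoef N L ε * hardScale N L ε = 2 * ε / √(N : ℝ) := by
  unfold hardCoef hardScale
  have h0 : 0 < √(N : ℝ) := by positivity
  have hs : (N : ℝ) = √(N : ℝ) ^ 2 := (Real.sq_sqrt (by positivity)).symm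
  generalize √(N : ℝ) = s at *
  rw [hs]
  field_simp
  norm_num

/-- This identity explains the scaling constants: the Lipschitz bound `75π` of the chain gradient
rescales to exactly `L`. -/
theorem hardCoef_mul_hardScale_sq (hN : 0 < N) (hL : 0 < L) (hε : 0 < ε) :
    hardCoef N L ε * hardScale N L ε * hardScale N L ε * (75 * Real.pi) = L := by
  rw [hardCoef_mul_hardScale hN hL hε]
  unfold hardScale
  have h0 : 0 < √(N : ℝ) := by positivity
  field_simp
  norm_num

end scaling

variable {m₁ m₂ dbar : ℕ} {L ε β : ℝ}

theorem hardInstance_f₀ (hd : Odd dbar) :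
    (hardInstance m₁ m₂ dbar L ε β).f₀ =
      smoothPart (m₁ * m₂) (hardCoef (3 * m₁ * m₂) L ε) (hardScale (3 * m₁ * m₂) L ε) := by
  funext x
  simp only [hardInstance, smoothPart, blockF, hardCoef, blockChain, hardScale,
    blockH_eq_sum hd, mul_assoc]
  refine Finset.sum_congr rfl fun i _ => ?_
  have e : (fun j => √((3 * (m₁ * m₂) : ℕ) : ℝ) * (L * x (i, j)) / (150 * (Real.pi * ε))) =
      fun j => √((3 * (m₁ * m₂) : ℕ) : ℝ) * L / (150 * (Real.pi * ε)) * x (i, j) := by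
    funext j; ring
  rw [e]

/-- The nonsmooth part `g(x) = β ∑ ‖x_i - x_{i+1}‖₁`, the sum being over `ℳ`. -/
def totalVar (m₁ m₂ : ℕ) (β : ℝ) (x : EuclideanSpace ℝ (Fin (3 * m₁ * m₂) × Fin dbar)) : ℝ :=
  β * ∑ rk : RowM m₁ m₂ × Fin dbar, |x (hi rk.1.1, rk.2) - x (lo rk.1.1, rk.2)|

theorem totalVar_nonneg (hβ : 0 ≤ β) (x : EuclideanSpace ℝ (Fin (3 * m₁ * m₂) × Fin dbar)) :
    0 ≤ totalVar m₁ m₂ β x :=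
  mul_nonneg hβ (Finset.sum_nonneg fun _ _ => abs_nonneg _)

theorem totalVar_zero :
    totalVar m₁ m₂ β (0 : EuclideanSpace ℝ (Fin (3 * m₁ * m₂) × Fin dbar)) = 0 := by
  simp [totalVar]

theorem hardInstance_g (hN : 0 < 3 * m₁ * m₂) (hL : 0 < L)
    (x : EuclideanSpace ℝ (Fin (3 * m₁ * m₂) × Fin dbar)) :
    (hardInstance m₁ m₂ dbar L ε β).g x = ((totalVar m₁ m₂ β x : ℝ) : EReal) := by
  have hs : 0 < ((3 * m₁ * m₂ : ℕ) : ℝ) * L := by positivity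
  simp only [Problem.g, hardInstance, add_zero]
  congr 1
  unfold totalVar
  have e : ∀ rk : RowM m₁ m₂ × Fin dbar,
      |Matrix.toEuclideanLin (hardAbar m₁ m₂ dbar L) x rk| =
        ((3 * m₁ * m₂ : ℕ) : ℝ) * L * |x (hi rk.1.1, rk.2) - x (lo rk.1.1, rk.2)| := by
    rintro ⟨r, k⟩
    rw [hardAbar_apply, abs_mul, abs_of_pos hs]
  rw [Finset.sum_congr rfl fun rk _ => e rk, ← Finset.mul_sum, ← mul_assoc,
    div_mul_cancel₀ _ hs.ne']

/-! ### Admissibility and function gap of the instance -/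

theorem ProperLscConvex.of_real {ι : Type*} [Fintype ι] {G : EuclideanSpace ℝ ι → ℝ}
    (hc : Continuous G) (hconv : ConvexOn ℝ Set.univ G) :
    ProperLscConvex fun x => (G x : EReal) where
  ne_bot x := EReal.coe_ne_bot _
  exists_ne_top := ⟨0, EReal.coe_ne_top _⟩
  lsc := (continuous_coe_real_ereal.comp hc).lowerSemicontinuous
  convex := by
    simpa using hconv.convex_epigraph

theorem ProperLscConvex.comp_affine {ι κ : Type*} [Fintype ι] [Fintype κ]
    {G : EuclideanSpace ℝ κ → EReal} (hG : ProperLscConvex G)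
    (T : EuclideanSpace ℝ ι →ₗ[ℝ] EuclideanSpace ℝ κ) (b : EuclideanSpace ℝ κ)
    (hne : ∃ x, G (T x + b) ≠ ⊤) : ProperLscConvex fun x => G (T x + b) where
  ne_bot x := hG.ne_bot _
  exists_ne_top := hne
  lsc := hG.lsc.comp ((T.continuous_of_finiteDimensional).add continuous_const)
  convex := by
    intro p hp p' hp' s t hs ht hst
    have h := hG.convex (x := (T p.1 + b, p.2)) hp (y := (T p'.1 + b, p'.2)) hp' hs ht hst
    simp only [Set.mem_ofPred_eq, Prod.smul_mk, Prod.mk_add_mk, Prod.fst_add, Prod.smul_fst,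
      Prod.snd_add, Prod.smul_snd, map_add, map_smul] at h ⊢
    have e : s • (T p.1 + b) + t • (T p'.1 + b) = s • T p.1 + t • T p'.1 + b := by
      rw [smul_add, smul_add]
      nth_rewrite 3 [← one_smul ℝ b]
      rw [← hst, add_smul]
      abel
    rwa [e] at h

theorem properLscConvex_mul_sum_abs {κ : Type*} [Fintype κ] {c : ℝ} (hc : 0 ≤ c) :
    ProperLscConvex fun y : EuclideanSpace ℝ κ => ((c * ∑ k, |y k| : ℝ) : EReal) := by
  refine ProperLscConvex.of_real (by fun_prop) ⟨convex_univ, ?_⟩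
  intro x _ y _ s t hs ht _
  simp only [smul_eq_mul, PiLp.add_apply, PiLp.smul_apply]
  have h : ∑ k, |s * x k + t * y k| ≤ s * ∑ k, |x k| + t * ∑ k, |y k| := by
    rw [Finset.mul_sum, Finset.mul_sum, ← Finset.sum_add_distrib]
    refine Finset.sum_le_sum fun k _ => (abs_add_le _ _).trans ?_
    rw [abs_mul, abs_mul, abs_of_nonneg hs, abs_of_nonneg ht]
  nlinarith [mul_le_mul_of_nonneg_left h hc]

theorem hardInstance_F₀ (hN : 0 < 3 * m₁ * m₂) (hL : 0 < L)
    (x : EuclideanSpace ℝ (Fin (3 * m₁ * m₂) × Fin dbar)) :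
    (hardInstance m₁ m₂ dbar L ε β).F₀ x =
      (((hardInstance m₁ m₂ dbar L ε β).f₀ x + totalVar m₁ m₂ β x : ℝ) : EReal) := by
  rw [Problem.F₀, hardInstance_g hN hL, EReal.coe_add]

theorem le_iInf_hardInstance_F₀ (hN : 0 < 3 * m₁ * m₂) (hL : 0 < L) (hε : 0 < ε) (hβ : 0 ≤ β)
    (hd : Odd dbar) :
    ((-(1200 * Real.pi ^ 2 * ε ^ 2 * dbar / L) : ℝ) : EReal) ≤
      ⨅ x, (hardInstance m₁ m₂ dbar L ε β).F₀ x := by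
  refine le_iInf fun x => ?_
  rw [hardInstance_F₀ hN hL, EReal.coe_le_coe_iff, hardInstance_f₀ hd]
  have h := neg_le_smoothPart (mul_assoc 3 m₁ m₂) (hardCoef_pos hN hL hε).le
    (hardScale (3 * m₁ * m₂) L ε) hd.pos x
  have hN' : (0 : ℝ) < ((3 * m₁ * m₂ : ℕ) : ℝ) := by exact_mod_cast hN
  have e : hardCoef (3 * m₁ * m₂) L ε * (((3 * m₁ * m₂ : ℕ) : ℝ) * dbar * (4 * Real.pi)) =
      1200 * Real.pi ^ 2 * ε ^ 2 * dbar / L := by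
    unfold hardCoef
    field_simp
    ring
  rw [e] at h
  linarith [totalVar_nonneg hβ x]

theorem hardInstance_gap_le (hN : 0 < 3 * m₁ * m₂) (hL : 0 < L) (hε : 0 < ε) (hβ : 0 ≤ β)
    (hd : Odd dbar) :
    (hardInstance m₁ m₂ dbar L ε β).gap 0 ≤ 1200 * Real.pi ^ 2 * ε ^ 2 * dbar / L := by
  have h1 := le_iInf_hardInstance_F₀ (m₁ := m₁) (m₂ := m₂) hN hL hε hβ hd
  have h2 : ⨅ x, (hardInstance m₁ m₂ dbar L ε β).F₀ x ≤
      (hardInstance m₁ m₂ dbar L ε β).F₀ 0 := iInf_le _ _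
  have h3 := smoothPart_zero_nonpos (N := 3 * m₁ * m₂) (dbar := dbar) (m₁ * m₂)
    (hardCoef_pos hN hL hε).le (hardScale (3 * m₁ * m₂) L ε)
  unfold Problem.gap
  rw [hardInstance_F₀ hN hL, totalVar_zero, add_zero, hardInstance_f₀ hd] at *
  generalize smoothPart (m₁ * m₂) (hardCoef (3 * m₁ * m₂) L ε) (hardScale (3 * m₁ * m₂) L ε)
    (0 : EuclideanSpace ℝ (Fin (3 * m₁ * m₂) × Fin dbar)) = r at *
  generalize ⨅ x, (hardInstance m₁ m₂ dbar L ε β).F₀ x = I at *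
  induction I with
  | bot => simp at h1
  | top => simp at h2
  | coe I =>
    rw [← EReal.coe_sub, EReal.toReal_coe]
    rw [EReal.coe_le_coe_iff] at h1
    linarith

theorem hardInstance_admissible (hN : 0 < 3 * m₁ * m₂) (hL : 0 < L) (hε : 0 < ε) (hβ : 0 ≤ β)
    (hd : Odd dbar) : (hardInstance m₁ m₂ dbar L ε β).Admissible L := by
  have hbar : ProperLscConvex (hardInstance m₁ m₂ dbar L ε β).gbar :=
    properLscConvex_mul_sum_abs (div_nonneg hβ (by positivity))
  refine ⟨?_, ?_, ?_, ?_, hbar⟩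
  · rw [hardInstance_f₀ hd]
    exact fun x => (hasFDerivAt_smoothPart _ _ _ x).differentiableAt
  · intro x x'
    rw [hardInstance_f₀ hd]
    refine (norm_gradient_smoothPart_sub_le _ (hardCoef_pos hN hL hε).le
      (hardScale_pos hN hL hε).le x x').trans ?_
    rw [hardCoef_mul_hardScale_sq hN hL hε]
  · exact (EReal.bot_lt_coe _).trans_le (le_iInf_hardInstance_F₀ hN hL hε hβ hd)
  · exact hbar.comp_affine _ _ ⟨0, EReal.coe_ne_top _⟩

/-! ### Stationary points -/

/-- The vector that is `1` in coordinate `k` of the first `n` blocks and zero elsewhere. -/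
def blockIndicator {N : ℕ} (n : ℕ) (k : Fin dbar) : EuclideanSpace ℝ (Fin N × Fin dbar) :=
  WithLp.toLp 2 fun ik => if (ik.1 : ℕ) < n ∧ ik.2 = k then 1 else 0

theorem blockIndicator_apply {N : ℕ} (n : ℕ) (k : Fin dbar) (i : Fin N) (k' : Fin dbar) :
    (blockIndicator n k : EuclideanSpace ℝ (Fin N × Fin dbar)) (i, k') =
      if (i : ℕ) < n ∧ k' = k then 1 else 0 := rfl

theorem inner_blockIndicator {N : ℕ} (n : ℕ) (k : Fin dbar)
    (w : EuclideanSpace ℝ (Fin N × Fin dbar)) :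
    inner ℝ w (blockIndicator n k) = ∑ i : Fin N, if (i : ℕ) < n then w (i, k) else 0 := by
  rw [PiLp.inner_apply, Fintype.sum_prod_type]
  refine Finset.sum_congr rfl fun i _ => ?_
  rw [Finset.sum_eq_single k]
  · simp [blockIndicator_apply]
  · intro k' _ hk'
    simp [blockIndicator_apply, hk']
  · simp

theorem norm_blockIndicator_le {N : ℕ} (n : ℕ) (k : Fin dbar) :
    ‖(blockIndicator n k : EuclideanSpace ℝ (Fin N × Fin dbar))‖ ≤ √(N : ℝ) := by
  rw [Real.le_sqrt (norm_nonneg _) (by positivity), ← real_inner_self_eq_norm_sq,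
    inner_blockIndicator]
  refine (Finset.sum_le_sum (g := fun _ => (1 : ℝ)) fun i _ => ?_).trans (by simp)
  rw [blockIndicator_apply]
  split_ifs <;> norm_num

theorem blockIndicator_hi_sub_lo {N : ℕ} (n : ℕ) (k : Fin dbar) (r : Fin (N - 1))
    (k' : Fin dbar) :
    (blockIndicator n k : EuclideanSpace ℝ (Fin N × Fin dbar)) (hi r, k') -
      (blockIndicator n k : EuclideanSpace ℝ (Fin N × Fin dbar)) (lo r, k') =
      if (r : ℕ) + 1 = n ∧ k' = k then -1 else 0 := by
  rw [blockIndicator_apply, blockIndicator_apply]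
  simp only [hi, lo]
  by_cases hk : k' = k
  · rcases lt_trichotomy ((r : ℕ) + 1) n with h | h | h
    · have h1 : (r : ℕ) < n := by omega
      simp [hk, h, h1, h.ne]
    · have h1 : (r : ℕ) < n := by omega
      simp [hk, h, h1]
    · have h1 : ¬ (r : ℕ) < n := by omega
      have h2 : ¬ (r : ℕ) + 1 < n := by omega
      simp [hk, h1, h2, h.ne']
  · simp [hk]

/-- The only possible jump of the indicator is at a row of `ℳ`, which `A` does not contain. -/
theorem hardA_blockIndicator {n : ℕ} (hn : m₁ ∣ n) (k : Fin dbar) :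
    Matrix.toEuclideanLin (hardA m₁ m₂ dbar L) (blockIndicator n k) = 0 := by
  ext ⟨r, k'⟩
  rw [hardA_apply, blockIndicator_hi_sub_lo, if_neg]
  · simp
  · rintro ⟨h, -⟩
    exact r.2 (h ▸ hn)

theorem totalVar_add_blockIndicator_of_le {n : ℕ} (hn : 3 * m₁ * m₂ ≤ n) (k : Fin dbar)
    (x : EuclideanSpace ℝ (Fin (3 * m₁ * m₂) × Fin dbar)) (τ : ℝ) :
    totalVar m₁ m₂ β (x + τ • blockIndicator n k) = totalVar m₁ m₂ β x := by
  unfold totalVar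
  congr 1
  refine Finset.sum_congr rfl fun rk _ => ?_
  have h := blockIndicator_hi_sub_lo n k rk.1.1 rk.2
  have : ¬ ((rk.1.1 : ℕ) + 1 = n ∧ rk.2 = k) := by omega
  rw [if_neg this] at h
  simp only [PiLp.add_apply, PiLp.smul_apply, smul_eq_mul]
  congr 1
  linear_combination τ * h

/-- Moving the first blocks by the size of the jump closes exactly this jump and leaves every other
difference across `ℳ` unchanged. -/
theorem totalVar_add_blockIndicator (r : RowM m₁ m₂) (k : Fin dbar)
    (x : EuclideanSpace ℝ (Fin (3 * m₁ * m₂) × Fin dbar)) :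
    totalVar m₁ m₂ β
      (x + (x (hi r.1, k) - x (lo r.1, k)) • blockIndicator ((r.1 : ℕ) + 1) k) =
      totalVar m₁ m₂ β x - β * |x (hi r.1, k) - x (lo r.1, k)| := by
  unfold totalVar
  rw [← mul_sub, ← Finset.add_sum_erase _ _ (Finset.mem_univ (r, k)),
    ← Finset.add_sum_erase (a := (r, k)) _ _ (Finset.mem_univ (r, k)), add_sub_cancel_left]
  congr 1
  have h0 := blockIndicator_hi_sub_lo ((r.1 : ℕ) + 1) k r.1 k
  rw [if_pos ⟨rfl, rfl⟩] at h0
  have h1 : ∀ τ : ℝ,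
      (x + τ • blockIndicator ((r.1 : ℕ) + 1) k : EuclideanSpace ℝ _) (hi r.1, k) -
        (x + τ • blockIndicator ((r.1 : ℕ) + 1) k : EuclideanSpace ℝ _) (lo r.1, k) =
      x (hi r.1, k) - x (lo r.1, k) - τ := by
    intro τ
    simp only [PiLp.add_apply, PiLp.smul_apply, smul_eq_mul]
    linear_combination τ * h0
  rw [h1, sub_self, abs_zero, zero_add]
  refine Finset.sum_congr rfl fun rk hrk => ?_
  have h := blockIndicator_hi_sub_lo ((r.1 : ℕ) + 1) k rk.1.1 rk.2
  have : ¬ ((rk.1.1 : ℕ) + 1 = (r.1 : ℕ) + 1 ∧ rk.2 = k) := by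
    rintro ⟨e1, e2⟩
    exact Finset.ne_of_mem_erase hrk
      (Prod.ext (Subtype.ext (Fin.ext (Nat.add_right_cancel e1))) e2)
  rw [if_neg this] at h
  simp only [PiLp.add_apply, PiLp.smul_apply, smul_eq_mul]
  congr 1
  linear_combination (x (hi r.1, k) - x (lo r.1, k)) * h

/-- Telescoping followed by Cauchy–Schwarz. -/
theorem sq_sub_le_sum_differences {N : ℕ} (y : Fin N → ℝ) (i j : Fin N) :
    (y i - y j) ^ 2 ≤ N * ∑ r : Fin (N - 1), (y (hi r) - y (lo r)) ^ 2 := by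
  wlog hij : j ≤ i generalizing i j
  · have := this j i (le_of_not_ge hij)
    nlinarith
  set Y : ℕ → ℝ := fun n => if h : n < N then y ⟨n, h⟩ else 0 with hY
  have h1 : y i - y j = ∑ n ∈ Finset.Ico (j : ℕ) i, (Y (n + 1) - Y n) := by
    rw [Finset.sum_Ico_sub _ (by exact_mod_cast hij)]
    simp [hY]
  have h2 : ∑ r : Fin (N - 1), (y (hi r) - y (lo r)) ^ 2 =
      ∑ n ∈ Finset.range (N - 1), (Y (n + 1) - Y n) ^ 2 := by
    rw [← Fin.sum_univ_eq_sum_range (fun n => (Y (n + 1) - Y n) ^ 2)]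
    refine Finset.sum_congr rfl fun r _ => ?_
    have a1 : (r : ℕ) + 1 < N := by omega
    have a2 : (r : ℕ) < N := by omega
    simp [hY, a1, a2, hi, lo]
  rw [h1, h2]
  refine sq_sum_le_card_mul_sum_sq.trans (mul_le_mul ?_ ?_
    (Finset.sum_nonneg fun _ _ => sq_nonneg _) (by positivity))
  · rw [Nat.card_Ico]
    have := i.2
    exact_mod_cast (by omega : (i : ℕ) - j ≤ N)
  · refine Finset.sum_le_sum_of_subset_of_nonneg ?_ fun _ _ _ => sq_nonneg _
    intro n hn
    rw [Finset.mem_Ico] at hn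
    rw [Finset.mem_range]
    omega

/-- The distance is an infimum, so a concrete subgradient is available only at the price of a
slightly larger tolerance. -/
theorem Problem.IsStationary.exists_lt {ι κ κ' : Type} [Fintype ι] [Fintype κ] [Fintype κ']
    [DecidableEq ι] [DecidableEq κ] {P : Problem ι κ κ'} {ε ε' : ℝ}
    {x : EuclideanSpace ℝ ι} (h : P.IsStationary ε x) (hε : 0 ≤ ε) (hlt : ε < ε') :
    ‖Matrix.toEuclideanLin P.A x + P.b‖ ≤ ε ∧ ∃ γ, ∃ v ∈ subdifferential P.g x,
      ‖gradient P.f₀ x + Matrix.toEuclideanLin P.A.transpose γ + v‖ < ε' := by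
  obtain ⟨γ, h1, h2⟩ := h
  refine ⟨h2, γ, ?_⟩
  have h3 : ENNReal.ofReal ε < ENNReal.ofReal ε' :=
    (ENNReal.ofReal_lt_ofReal_iff (hε.trans_lt hlt)).2 hlt
  obtain ⟨_, ⟨v, hv, rfl⟩, hd⟩ := Metric.infEDist_lt_iff.1 (h1.trans_lt h3)
  refine ⟨v, hv, ?_⟩
  rw [edist_comm, edist_zero_right, ← ofReal_norm,
    ENNReal.ofReal_lt_ofReal_iff (hε.trans_lt hlt)] at hd
  exact hd

end

/-! ### Near-stationary points have a nonzero last coordinate -/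

section

variable {m₁ m₂ dbar : ℕ} {L ε β : ℝ}

/-- The averaged chain grows: if the averaged partial derivatives are small, no coordinate of the
chain is smaller than `1` in absolute value. -/
theorem one_le_abs_of_sum_chainDeriv {N q : ℕ} (hN : N = 3 * q) (hN0 : 0 < N) (y : ℕ → ℝ)
    (h0 : y 0 = 1)
    (hy : ∀ k, 1 ≤ k → k ≤ dbar → -(9 / 8 * (N : ℝ)) ≤ ∑ i : Fin N, chainDeriv q dbar i y k) :
    ∀ k ≤ dbar, 1 ≤ |y k| := by
  intro k
  induction k with
  | zero => intro _; simp [h0]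
  | succ k ih =>
    intro hk
    by_contra! hlt
    have hN' : (0 : ℝ) < N := by exact_mod_cast hN0
    have h1 := hy (k + 1) (by omega) hk
    simp only [chainDeriv, Finset.sum_add_distrib, ← Finset.sum_mul, add_tsub_cancel_right] at h1
    rw [sum_weight hN _ _ (by omega), if_pos (Or.inr hk)] at h1
    have h2 : (∑ i : Fin N, weight q dbar i (k + 1 + 1)) * lamU (y (k + 1)) (y (k + 1 + 1)) ≤ 0 :=
      mul_nonpos_of_nonneg_of_nonpos (Finset.sum_nonneg fun _ _ => weight_nonneg _ _ _ _)
        (lamU_nonpos _ _)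
    have h3 := lamV_le_of_one_le_abs (ih (by omega)) hlt
    nlinarith

theorem subdifferential_hardInstance (hN : 0 < 3 * m₁ * m₂) (hL : 0 < L)
    {x v : EuclideanSpace ℝ (Fin (3 * m₁ * m₂) × Fin dbar)}
    (hv : v ∈ subdifferential (hardInstance m₁ m₂ dbar L ε β).g x)
    (d : EuclideanSpace ℝ (Fin (3 * m₁ * m₂) × Fin dbar)) (τ : ℝ) :
    totalVar m₁ m₂ β x + τ * inner ℝ v d ≤ totalVar m₁ m₂ β (x + τ • d) := by
  have h := hv.2 (x + τ • d)
  rw [hardInstance_g hN hL, hardInstance_g hN hL, ← EReal.coe_add, EReal.coe_le_coe_iff,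
    add_sub_cancel_left, real_inner_smul_right] at h
  exact h

theorem exists_last_ne_zero (hN : 0 < 3 * m₁ * m₂) (hL : 0 < L) (hε : 0 < ε)
    (hβ : (50 * Real.pi + 1) * √((3 * m₁ * m₂ : ℕ) : ℝ) * ε < β)
    (hd : Odd dbar) {ω : ℝ} (hω : ω < 150 * Real.pi * ε / L)
    (x₀ : EuclideanSpace ℝ (Fin (3 * m₁ * m₂) × Fin dbar))
    (hx₀ : (hardInstance m₁ m₂ dbar L ε β).IsNearStationary ω ε x₀) :
    ∃ i, ∃ k : Fin dbar, (k : ℕ) + 1 = dbar ∧ x₀ (i, k) ≠ 0 := by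
  obtain ⟨x, hstat, hdist⟩ := hx₀
  -- The slack `5/4` is affordable: it leads to `5/8 + 1/2 = 9/8 < 5/4` below.
  obtain ⟨hA, γ, v, hv, hres⟩ := hstat.exists_lt hε.le (by linarith : ε < 5 / 4 * ε)
  rw [hardInstance_f₀ hd] at hres
  have hsub := subdifferential_hardInstance hN hL hv
  change ‖Matrix.toEuclideanLin (hardA m₁ m₂ dbar L) x + 0‖ ≤ ε at hA
  change ‖_ + Matrix.toEuclideanLin (hardA m₁ m₂ dbar L).transpose γ + v‖ < _ at hres
  rw [add_zero] at hA
  have hNq : 3 * m₁ * m₂ = 3 * (m₁ * m₂) := mul_assoc 3 m₁ m₂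
  have hdvd : m₁ ∣ 3 * m₁ * m₂ := ⟨3 * m₂, by ring⟩
  have hc := hardCoef_pos hN hL hε
  have ha := hardScale_pos hN hL hε
  have hca := hardCoef_mul_hardScale hN hL hε
  have hs0 : 0 < √((3 * m₁ * m₂ : ℕ) : ℝ) := by positivity
  have hss : √((3 * m₁ * m₂ : ℕ) : ℝ) ^ 2 = ((3 * m₁ * m₂ : ℕ) : ℝ) :=
    Real.sq_sqrt (by positivity)
  have hN' : (0 : ℝ) < ((3 * m₁ * m₂ : ℕ) : ℝ) := by exact_mod_cast hN
  have hadef : hardScale (3 * m₁ * m₂) L ε =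
    √((3 * m₁ * m₂ : ℕ) : ℝ) * L / (150 * Real.pi * ε) := rfl
  have hπ := Real.pi_gt_three
  set a := hardScale (3 * m₁ * m₂) L ε
  set c := hardCoef (3 * m₁ * m₂) L ε
  set G := gradient (smoothPart (m₁ * m₂) c a) x with hG
  -- testing the residual against the indicator of the first `n` blocks
  have htest : ∀ n : ℕ, m₁ ∣ n → ∀ k : Fin dbar,
      |inner ℝ G (blockIndicator n k) + inner ℝ v (blockIndicator n k)| ≤
        √((3 * m₁ * m₂ : ℕ) : ℝ) * (5 / 4 * ε) := by
    intro n hn k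
    have h1 := abs_real_inner_le_norm
      (G + Matrix.toEuclideanLin (hardA m₁ m₂ dbar L).transpose γ + v) (blockIndicator n k)
    rw [inner_add_left, inner_add_left, inner_toEuclideanLin_transpose, hardA_blockIndicator hn,
      inner_zero_right, add_zero] at h1
    refine h1.trans ?_
    rw [mul_comm]
    exact mul_le_mul (norm_blockIndicator_le n k) hres.le (norm_nonneg _) hs0.le
  have hGapply : ∀ i k, G (i, k) =
      c * a * chainDeriv (m₁ * m₂) dbar i (blockChain a x i) (k + 1) :=
    fun i k => gradient_smoothPart _ _ _ x i k
  -- the nonsmooth part of the residual forces equality across `ℳ`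
  have hM : ∀ (r : RowM m₁ m₂) (k : Fin dbar), x (hi r.1, k) - x (lo r.1, k) = 0 := by
    intro r k
    by_contra hne
    have h1 := hsub (blockIndicator ((r.1 : ℕ) + 1) k) (x (hi r.1, k) - x (lo r.1, k))
    rw [totalVar_add_blockIndicator] at h1
    have h2 := htest _ r.2 k
    set τ := x (hi r.1, k) - x (lo r.1, k)
    have hτ : 0 < |τ| := abs_pos.2 hne
    have h3 : |inner ℝ G (blockIndicator ((r.1 : ℕ) + 1) k)| ≤
        √((3 * m₁ * m₂ : ℕ) : ℝ) * (2 * ε * (12 + 12 * Real.pi)) := by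
      rw [inner_blockIndicator]
      refine (Finset.abs_sum_le_sum_abs _ _).trans ?_
      refine (Finset.sum_le_sum (g := fun _ => c * a * (12 + 12 * Real.pi)) fun i _ => ?_).trans ?_
      · split_ifs
        · rw [hGapply, abs_mul, abs_of_pos (mul_pos hc ha)]
          exact mul_le_mul_of_nonneg_left (abs_chainDeriv_le _ _ _ _ _) (mul_pos hc ha).le
        · rw [abs_zero]; positivity
      · rw [Finset.sum_const, Finset.card_univ, Fintype.card_fin, nsmul_eq_mul, hca]
        refine le_of_eq ?_
        field_simp
        exact hss.symm
    -- The residual and the gradient contribute at most `(5/4 + 24 + 24π) √m ε`, below `(50π + 1) √m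
    -- ε`. Closing the jump would lower `g` by `β |τ|`, more than this subgradient allows.
    have h4 : |inner ℝ v (blockIndicator ((r.1 : ℕ) + 1) k)| < β := by
      have h5 := abs_sub (inner ℝ G (blockIndicator ((r.1 : ℕ) + 1) k) +
        inner ℝ v (blockIndicator ((r.1 : ℕ) + 1) k)) (inner ℝ G (blockIndicator ((r.1 : ℕ) + 1) k))
      rw [add_sub_cancel_left] at h5
      have h6 : 0 < √((3 * m₁ * m₂ : ℕ) : ℝ) * ε := by positivity
      nlinarith
    have h7 : -(τ * inner ℝ v (blockIndicator ((r.1 : ℕ) + 1) k)) ≤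
        |τ| * |inner ℝ v (blockIndicator ((r.1 : ℕ) + 1) k)| := by
      rw [← abs_mul]; exact neg_le_abs _
    nlinarith [mul_lt_mul_of_pos_left h4 hτ]
  -- the blocks are close to each other
  have hclose : ∀ i j k, |a * x (i, k) - a * x (j, k)| ≤ 1 / (150 * Real.pi) := by
    intro i j k
    have h1 := sq_sub_le_sum_differences (fun i => x (i, k)) i j
    have h2 : (((3 * m₁ * m₂ : ℕ) : ℝ) * L) ^ 2 *
        ∑ r : Fin (3 * m₁ * m₂ - 1), (x (hi r, k) - x (lo r, k)) ^ 2 ≤ ε ^ 2 := by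
      have h3 : ‖Matrix.toEuclideanLin (hardA m₁ m₂ dbar L) x‖ ^ 2 ≤ ε ^ 2 := by gcongr
      refine le_trans ?_ h3
      rw [EuclideanSpace.real_norm_sq_eq, Fintype.sum_prod_type,
        ← Fintype.sum_subtype_add_sum_subtype (fun r : Fin (3 * m₁ * m₂ - 1) => m₁ ∣ (r : ℕ) + 1)
          (fun r => (x (hi r, k) - x (lo r, k)) ^ 2),
        Finset.sum_eq_zero (fun (r : RowM m₁ m₂) _ => by rw [hM r k]; norm_num), zero_add,
        Finset.mul_sum]
      refine Finset.sum_le_sum fun r _ => ?_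
      have h4 := Finset.single_le_sum (f := fun k' =>
        (Matrix.toEuclideanLin (hardA m₁ m₂ dbar L) x (r, k')) ^ 2)
        (fun k' _ => sq_nonneg _) (Finset.mem_univ k)
      refine le_trans (le_of_eq ?_) h4
      rw [hardA_apply]
      ring
    rw [← mul_sub]
    refine abs_le_of_sq_le_sq ?_ (by positivity)
    have h5 : (((3 * m₁ * m₂ : ℕ) : ℝ) * L) ^ 2 * (x (i, k) - x (j, k)) ^ 2 ≤
        ((3 * m₁ * m₂ : ℕ) : ℝ) * ε ^ 2 := by
      have := mul_le_mul_of_nonneg_left h1 (sq_nonneg (((3 * m₁ * m₂ : ℕ) : ℝ) * L))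
      have := mul_le_mul_of_nonneg_left h2 hN'.le
      linarith
    have h6 : ((3 * m₁ * m₂ : ℕ) : ℝ) * L ^ 2 * (x (i, k) - x (j, k)) ^ 2 ≤ ε ^ 2 :=
      le_of_mul_le_mul_left (by linarith) hN'
    rw [mul_pow, hadef, div_pow, mul_pow, hss, div_mul_eq_mul_div, div_le_iff₀ (by positivity)]
    refine h6.trans (le_of_eq ?_)
    field_simp
  -- averaging
  set y : ℕ → ℝ := fun k => (∑ i, blockChain a x i k) / ((3 * m₁ * m₂ : ℕ) : ℝ) with hy
  have hyclose : ∀ i k, |blockChain a x i k - y k| ≤ 1 / (150 * Real.pi) := by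
    intro i k
    have e : blockChain a x i k - y k =
        (∑ j, (blockChain a x i k - blockChain a x j k)) / ((3 * m₁ * m₂ : ℕ) : ℝ) := by
      rw [hy, Finset.sum_sub_distrib, Finset.sum_const, Finset.card_univ, Fintype.card_fin,
        nsmul_eq_mul]
      field_simp
    rw [e, abs_div, abs_of_pos hN', div_le_iff₀ hN']
    refine (Finset.abs_sum_le_sum_abs _ _).trans ?_
    refine (Finset.sum_le_sum (g := fun _ => 1 / (150 * Real.pi)) fun j _ => ?_).trans ?_
    · rcases k with _ | k
      · rw [blockChain_zero, blockChain_zero, sub_self, abs_zero]; positivity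
      · rcases lt_or_ge k dbar with h | h
        · have e1 := blockChain_succ a x i ⟨k, h⟩
          have e2 := blockChain_succ a x j ⟨k, h⟩
          simp only at e1 e2
          rw [e1, e2]
          exact hclose i j ⟨k, h⟩
        · rw [blockChain_of_lt _ _ _ (by omega), blockChain_of_lt _ _ _ (by omega), sub_self,
            abs_zero]
          positivity
    · rw [Finset.sum_const, Finset.card_univ, Fintype.card_fin, nsmul_eq_mul, mul_comm]
  have hsum : ∀ k : Fin dbar, |∑ i : Fin (3 * m₁ * m₂),
      chainDeriv (m₁ * m₂) dbar i (blockChain a x i) (k + 1)| ≤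
        5 / 8 * ((3 * m₁ * m₂ : ℕ) : ℝ) := by
    intro k
    have h1 := htest _ hdvd k
    -- `g` is invariant under shifting all blocks together, so its subgradients are orthogonal to
    -- this direction.
    have h2 : inner ℝ v (blockIndicator (3 * m₁ * m₂) k) = (0 : ℝ) := by
      have h3 := hsub (blockIndicator (3 * m₁ * m₂) k) 1
      have h4 := hsub (blockIndicator (3 * m₁ * m₂) k) (-1)
      rw [totalVar_add_blockIndicator_of_le le_rfl] at h3 h4
      linarith
    rw [h2, add_zero, inner_blockIndicator] at h1
    simp only [Fin.is_lt, if_true, hGapply] at h1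
    rw [← Finset.mul_sum, abs_mul, abs_of_pos (mul_pos hc ha), hca, div_mul_eq_mul_div,
      div_le_iff₀ hs0] at h1
    have h5 : 2 * ε * |∑ i : Fin (3 * m₁ * m₂),
      chainDeriv (m₁ * m₂) dbar i (blockChain a x i) (k + 1)| ≤
        2 * ε * (5 / 8 * ((3 * m₁ * m₂ : ℕ) : ℝ)) := by
      rw [← hss]; linarith
    exact le_of_mul_le_mul_left h5 (by positivity)
  have hgrow := one_le_abs_of_sum_chainDeriv (dbar := dbar) hNq hN y
    (by
      simp only [hy, blockChain_zero, Finset.sum_const, Finset.card_univ, Fintype.card_fin,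
        nsmul_eq_mul, mul_one]
      exact div_self hN'.ne') (by
      intro k hk1 hk2
      have h1 := hsum ⟨k - 1, by omega⟩
      simp only [Nat.sub_add_cancel hk1] at h1
      -- Replacing each block by the average costs at most `(45 + 48π)/(150π) ≤ 1/2` per block.
      have h2 : ∀ i : Fin (3 * m₁ * m₂), chainDeriv (m₁ * m₂) dbar i (blockChain a x i) k -
          chainDeriv (m₁ * m₂) dbar i y k ≤ 1 / 2 := by
        intro i
        refine (le_abs_self _).trans ((abs_chainDeriv_sub_le _ _ _ _ _ _).trans ?_)
        have i1 := hyclose i (k - 1)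
        have i2 := mul_le_mul_of_nonneg_left (hyclose i k) (by positivity : 0 ≤ 9 + 48 * Real.pi)
        have i3 := hyclose i (k + 1)
        have i4 : (45 + 48 * Real.pi) * (1 / (150 * Real.pi)) ≤ 1 / 2 := by
          rw [mul_one_div, div_le_iff₀ (by positivity)]; linarith
        linarith
      have h3 := Finset.sum_le_sum fun i (_ : i ∈ Finset.univ) => h2 i
      rw [Finset.sum_sub_distrib, Finset.sum_const, Finset.card_univ, Fintype.card_fin,
        nsmul_eq_mul] at h3
      linarith [(abs_le.1 h1).1])
  by_contra! hzero
  have hdpos := hd.pos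
  set kl : Fin dbar := ⟨dbar - 1, by omega⟩ with hkl
  have hkl1 : (kl : ℕ) + 1 = dbar := by simp only [hkl]; omega
  have hyl := hgrow _ hkl1.le
  have e1 : y (kl + 1) = a * (∑ i, x (i, kl)) / ((3 * m₁ * m₂ : ℕ) : ℝ) := by
    simp only [hy, blockChain_succ, ← Finset.mul_sum]
  have h1 : ∑ i, x (i, kl) ^ 2 ≤ ‖x₀ - x‖ ^ 2 := by
    rw [EuclideanSpace.real_norm_sq_eq, Fintype.sum_prod_type]
    refine Finset.sum_le_sum fun i _ => ?_
    have h4 := Finset.single_le_sum (f := fun k' => (x₀ - x) (i, k') ^ 2)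
        (fun k' _ => sq_nonneg _) (Finset.mem_univ kl)
    refine le_trans (le_of_eq ?_) h4
    simp [hzero i kl hkl1]
  have h2 : (∑ i, x (i, kl)) ^ 2 ≤ ((3 * m₁ * m₂ : ℕ) : ℝ) * ∑ i, x (i, kl) ^ 2 := by
    simpa using sq_sum_le_card_mul_sum_sq (s := Finset.univ) (f := fun i => x (i, kl))
  have h3 : 1 ≤ y (kl + 1) ^ 2 := by rw [← sq_abs]; nlinarith
  -- The radius `150πε/L` is `√m / a`. If the last coordinates of `x₀` vanish, Cauchy–Schwarz and
  -- the average being at least `1` in absolute value give `‖x₀ - x‖ ≥ √m / a`.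
  have h4 : ‖x₀ - x‖ < √((3 * m₁ * m₂ : ℕ) : ℝ) / a := by
    refine (hdist.trans_lt hω).trans_le (le_of_eq ?_)
    rw [hadef]
    field_simp
  have h5 : ‖x₀ - x‖ ^ 2 < (√((3 * m₁ * m₂ : ℕ) : ℝ) / a) ^ 2 := by gcongr
  rw [div_pow, hss, lt_div_iff₀ (by positivity)] at h5
  rw [e1, div_pow, le_div_iff₀ (by positivity), mul_pow] at h3
  have h6 : ((3 * m₁ * m₂ : ℕ) : ℝ) ^ 2 ≤ ((3 * m₁ * m₂ : ℕ) : ℝ) * (‖x₀ - x‖ ^ 2 * a ^ 2) := by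
    have := mul_le_mul_of_nonneg_left h2 (sq_nonneg a)
    have := mul_le_mul_of_nonneg_left h1 (mul_nonneg hN'.le (sq_nonneg a))
    linarith
  nlinarith

end

section

/-! ### Propagation of the support -/

/-- The number of rows in `ℳᶜ` before the block `i`. -/
def blockPos (m₁ i : ℕ) : ℕ := i - i / m₁

theorem blockPos_succ_of_dvd {m₁ i : ℕ} (h : m₁ ∣ i + 1) :
    blockPos m₁ (i + 1) = blockPos m₁ i := by
  unfold blockPos
  have := Nat.div_le_self i m₁
  rw [Nat.succ_div, if_pos h]
  omega

theorem blockPos_succ_of_not_dvd {m₁ i : ℕ} (h : ¬ m₁ ∣ i + 1) :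
    blockPos m₁ (i + 1) = blockPos m₁ i + 1 := by
  unfold blockPos
  have := Nat.div_le_self i m₁
  rw [Nat.succ_div, if_neg h]
  omega

theorem monotone_blockPos (m₁ : ℕ) : Monotone (blockPos m₁) := by
  refine monotone_nat_of_le_succ fun i => ?_
  by_cases h : m₁ ∣ i + 1
  · rw [blockPos_succ_of_dvd h]
  · rw [blockPos_succ_of_not_dvd h]; omega

theorem blockPos_mul {m₁ : ℕ} (h : 0 < m₁) (n : ℕ) : blockPos m₁ (m₁ * n) = m₁ * n - n := by
  rw [blockPos, Nat.mul_div_cancel_left _ h]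

/-- A lower bound for the first iteration at which coordinate `k` (numbered from `1`) of the block
`i` can be nonzero. -/
def activation (m₁ m₂ k i : ℕ) : ℕ :=
  if k = 1 then 1
  else 2 + (k - 2) * (m₁ * m₂ - m₂ + 1) +
    if Even k then blockPos m₁ i - (m₁ * m₂ - m₂) else 2 * (m₁ * m₂ - m₂) - blockPos m₁ i

/-- Crossing a row of `ℳ` costs no time, which is what lets the timetable survive the proximal step.
-/
theorem activation_succ_of_dvd {m₁ i : ℕ} (m₂ k : ℕ) (h : m₁ ∣ i + 1) :
    activation m₁ m₂ k (i + 1) = activation m₁ m₂ k i := by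
  unfold activation
  rw [blockPos_succ_of_dvd h]

theorem activation_succ_of_not_dvd {m₁ i : ℕ} (m₂ k : ℕ) (h : ¬ m₁ ∣ i + 1) :
    activation m₁ m₂ k (i + 1) ≤ activation m₁ m₂ k i + 1 ∧
      activation m₁ m₂ k i ≤ activation m₁ m₂ k (i + 1) + 1 := by
  unfold activation
  rw [blockPos_succ_of_not_dvd h]
  split_ifs <;> constructor <;> omega

/-- In `activation`, each third contains `D = m₁m₂ - m₂` rows of `ℳᶜ`, and truncated subtraction
makes the travel cost zero in the third where the coordinate is born. Where link `k + 1` is present,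
coordinate `k + 1` is being born while coordinate `k`, if `k ≥ 2`, has already paid at least `D`;
only the gradient step remains. Coordinate `1` is born in all blocks at once. -/
theorem activation_next {m₁ m₂ k i : ℕ} (hm₁ : 0 < m₁) (hk : 1 ≤ k)
    (h : (i < m₁ * m₂ ∧ Even (k + 1)) ∨ (2 * (m₁ * m₂) ≤ i ∧ Odd (k + 1))) :
    activation m₁ m₂ (k + 1) i ≤ activation m₁ m₂ k i + 1 := by
  have hk1 : k + 1 ≠ 1 := by omega
  have hpos : activation m₁ m₂ (k + 1) i = 2 + (k - 1) * (m₁ * m₂ - m₂ + 1) := by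
    rw [activation, if_neg hk1, show k + 1 - 2 = k - 1 by omega]
    rcases h with ⟨h1, h2⟩ | ⟨h1, h2⟩
    · rw [if_pos h2]
      have := monotone_blockPos m₁ h1.le
      rw [blockPos_mul hm₁] at this
      omega
    · rw [if_neg (Nat.not_even_iff_odd.2 h2)]
      have := monotone_blockPos m₁ h1
      rw [show 2 * (m₁ * m₂) = m₁ * (2 * m₂) by ring, blockPos_mul hm₁,
        show m₁ * (2 * m₂) = 2 * (m₁ * m₂) by ring] at this
      omega
  rw [hpos]
  rcases eq_or_ne k 1 with rfl | hk'
  · simp [activation]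
  · obtain ⟨n, rfl⟩ : ∃ n, k = n + 2 := ⟨k - 2, by omega⟩
    rw [activation, if_neg hk', show n + 2 - 1 = n + 1 by omega, show n + 2 - 2 = n by omega,
      Nat.succ_mul]
    rcases h with ⟨h1, h2⟩ | ⟨h1, h2⟩
    · have h3 : ¬ Even (n + 2) := fun h => by
        rw [Nat.even_add_one] at h2
        exact h2 h
      rw [if_neg h3]
      have := monotone_blockPos m₁ h1.le
      rw [blockPos_mul hm₁] at this
      omega
    · have h3 : Even (n + 2) := by
        rw [← Nat.not_even_iff_odd, Nat.even_add_one, not_not] at h2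
        exact h2
      rw [if_pos h3]
      have := monotone_blockPos m₁ h1
      rw [show 2 * (m₁ * m₂) = m₁ * (2 * m₂) by ring, blockPos_mul hm₁,
        show m₁ * (2 * m₂) = 2 * (m₁ * m₂) by ring] at this
      omega

variable {m₁ m₂ dbar : ℕ} {L ε β : ℝ}

/-- The proximal map of `g` does not enlarge the support beyond `ℳ`-adjacent blocks. -/
theorem IsProx.eq_zero_of_closed (hN : 0 < 3 * m₁ * m₂) (hL : 0 < L) (hβ : 0 ≤ β) {η : ℝ}
    (hη : 0 < η) {ξ ζ : EuclideanSpace ℝ (Fin (3 * m₁ * m₂) × Fin dbar)}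
    (h : IsProx (hardInstance m₁ m₂ dbar L ε β).g η ξ ζ)
    (S : Fin (3 * m₁ * m₂) × Fin dbar → Prop)
    (hS : ∀ (r : RowM m₁ m₂) k, S (hi r.1, k) ↔ S (lo r.1, k)) (hξ : ∀ p, S p → ξ p = 0) :
    ∀ p, S p → ζ p = 0 := by
  classical
  -- Zeroing `ζ` on `S` does not increase `g`, since both ends of a row of `ℳ` are zeroed or neither
  -- is, and it brings `ζ` closer to `ξ` unless `ζ` already vanishes on `S`.
  set z : EuclideanSpace ℝ (Fin (3 * m₁ * m₂) × Fin dbar) :=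
    WithLp.toLp 2 fun p => if S p then 0 else ζ p with hz
  have hzp : ∀ p, z p = if S p then 0 else ζ p := fun p => rfl
  have h1 := h z
  rw [hardInstance_g hN hL, hardInstance_g hN hL, ← EReal.coe_add, ← EReal.coe_add,
    EReal.coe_le_coe_iff] at h1
  have h2 : totalVar m₁ m₂ β z ≤ totalVar m₁ m₂ β ζ := by
    refine mul_le_mul_of_nonneg_left (Finset.sum_le_sum fun rk _ => ?_) hβ
    rw [hzp, hzp]
    by_cases hs : S (lo rk.1.1, rk.2)
    · rw [if_pos hs, if_pos ((hS rk.1 rk.2).2 hs), sub_self, abs_zero]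
      exact abs_nonneg _
    · rw [if_neg hs, if_neg (fun h => hs ((hS rk.1 rk.2).1 h))]
  have h3 : 1 / (2 * η) * ‖ζ - ξ‖ ^ 2 ≤ 1 / (2 * η) * ‖z - ξ‖ ^ 2 := by linarith
  have h4 : ‖ζ - ξ‖ ^ 2 ≤ ‖z - ξ‖ ^ 2 := le_of_mul_le_mul_left h3 (by positivity)
  have h5 : ‖ζ - ξ‖ ^ 2 = ‖z - ξ‖ ^ 2 + ∑ p, if S p then ζ p ^ 2 else 0 := by
    rw [EuclideanSpace.real_norm_sq_eq, EuclideanSpace.real_norm_sq_eq, ← Finset.sum_add_distrib]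
    refine Finset.sum_congr rfl fun p _ => ?_
    simp only [PiLp.sub_apply, hzp]
    split_ifs with hp
    · rw [hξ p hp]; ring
    · ring
  have h6 : ∀ p ∈ Finset.univ, 0 ≤ if S p then ζ p ^ 2 else 0 := fun p _ => by
    split_ifs <;> positivity
  have h7 : ∑ p, (if S p then ζ p ^ 2 else 0) = 0 :=
    le_antisymm (by linarith) (Finset.sum_nonneg h6)
  intro p hp
  have h8 := (Finset.sum_eq_zero_iff_of_nonneg h6).1 h7 p (Finset.mem_univ p)
  rw [if_pos hp] at h8
  exact pow_eq_zero_iff (two_ne_zero) |>.1 h8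

theorem hardA_transpose_mul_self_apply_eq_zero
    (x : EuclideanSpace ℝ (Fin (3 * m₁ * m₂) × Fin dbar)) (i : Fin (3 * m₁ * m₂)) (k : Fin dbar)
    (h : ∀ r : RowMc m₁ m₂, (i = hi r.1 ∨ i = lo r.1) → x (hi r.1, k) = 0 ∧ x (lo r.1, k) = 0) :
    Matrix.toEuclideanLin (hardA m₁ m₂ dbar L).transpose
      (Matrix.toEuclideanLin (hardA m₁ m₂ dbar L) x) (i, k) = 0 := by
  have e : Matrix.toEuclideanLin (hardA m₁ m₂ dbar L).transpose
      (Matrix.toEuclideanLin (hardA m₁ m₂ dbar L) x) (i, k) =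
      inner ℝ (Matrix.toEuclideanLin (hardA m₁ m₂ dbar L) x)
        (Matrix.toEuclideanLin (hardA m₁ m₂ dbar L) (EuclideanSpace.single (i, k) 1)) := by
    rw [← inner_toEuclideanLin_transpose, EuclideanSpace.inner_single_right]
    simp
  rw [e, PiLp.inner_apply]
  refine Finset.sum_eq_zero ?_
  rintro ⟨r, k'⟩ _
  rw [hardA_apply, hardA_apply]
  by_cases hk : k' = k
  · subst hk
    by_cases hr : i = hi r.1 ∨ i = lo r.1
    · rw [(h r hr).1, (h r hr).2]; simp
    · rw [not_or] at hr
      have h1 : (hi r.1, k') ≠ (i, k') := fun h => hr.1 (Prod.mk.inj h).1.symm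
      have h2 : (lo r.1, k') ≠ (i, k') := fun h => hr.2 (Prod.mk.inj h).1.symm
      simp [h1, h2]
  · have h1 : (hi r.1, k') ≠ (i, k) := fun h => hk (Prod.mk.inj h).2
    have h2 : (lo r.1, k') ≠ (i, k) := fun h => hk (Prod.mk.inj h).2
    simp [h1, h2]

/-- Zero-chain property: both partial derivatives of a link vanish when its first variable is `0`.
The outgoing link of an inactive coordinate thus contributes nothing, and its incoming link is
either absent from the block or starts at a zero coordinate by `activation_next`. -/
theorem gradient_apply_eq_zero (hm₁ : 0 < m₁) (c a : ℝ)
    {x : EuclideanSpace ℝ (Fin (3 * m₁ * m₂) × Fin dbar)} {s : ℕ}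
    (hx : ∀ (i : Fin (3 * m₁ * m₂)) (k : Fin dbar), s < activation m₁ m₂ (k + 1) i → x (i, k) = 0)
    (i : Fin (3 * m₁ * m₂)) (k : Fin dbar) (hik : s + 1 < activation m₁ m₂ (k + 1) i) :
    gradient (smoothPart (m₁ * m₂) c a) x (i, k) = 0 := by
  rw [gradient_smoothPart]
  have h1 : blockChain a x i (k + 1) = 0 := by
    rw [blockChain_succ, hx i k (by omega), mul_zero]
  have h2 : weight (m₁ * m₂) dbar i (k + 1) *
      lamV (blockChain a x i (k + 1 - 1)) (blockChain a x i (k + 1)) = 0 := by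
    obtain ⟨k, hk⟩ := k
    rcases k with _ | k
    · simp [activation] at hik
    · by_cases hw : (i : ℕ) < m₁ * m₂ ∧ Even (k + 1 + 1) ∨ 2 * (m₁ * m₂) ≤ (i : ℕ) ∧ Odd (k + 1 + 1)
      · have h3 := activation_next hm₁ (by omega) hw
        simp only at hik
        have h4 : blockChain a x i (k + 1) = 0 := by
          have h5 := blockChain_succ a x i ⟨k, by omega⟩
          simp only at h5
          rw [h5, hx i ⟨k, by omega⟩ (by simp only; omega), mul_zero]
        simp only [add_tsub_cancel_right]
        rw [h4, lamV_zero_left, mul_zero]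
      · have h3 : weight (m₁ * m₂) dbar i (k + 1 + 1) = 0 := by
          rw [weight, if_neg (by omega), if_neg (fun h => hw h.2)]
        simp only
        rw [h3, zero_mul]
  rw [chainDeriv, h2, h1, lamU_zero_left]
  simp

/-- One iteration advances the timetable by at most one: gradients by `gradient_apply_eq_zero`,
`AᵀA` because neighbours across `ℳᶜ` differ by at most one, and the proximal map because
`activation` is constant across `ℳ`. -/
theorem LinearSpan.eq_zero_of_lt_activation (hN : 0 < 3 * m₁ * m₂) (hm₁ : 0 < m₁) (hL : 0 < L)
    (hβ : 0 ≤ β) (hd : Odd dbar)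
    {x : ℕ → EuclideanSpace ℝ (Fin (3 * m₁ * m₂) × Fin dbar)} (hx0 : x 0 = 0)
    (hx : (hardInstance m₁ m₂ dbar L ε β).LinearSpan x) (t : ℕ) (i : Fin (3 * m₁ * m₂))
    (k : Fin dbar) (hik : t < activation m₁ m₂ (k + 1) i) : x t (i, k) = 0 := by
  induction t using Nat.strong_induction_on generalizing i k with
  | _ t ih =>
    rcases Nat.eq_zero_or_pos t with rfl | ht
    · simp [hx0]
    obtain ⟨ξ, ζ, hξ, ⟨η, hη, hprox⟩, hxt⟩ := hx t ht
    have hξ0 : ∀ (i : Fin (3 * m₁ * m₂)) (k : Fin dbar),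
        t < activation m₁ m₂ (k + 1) i → ξ (i, k) = 0 := by
      intro i k hik
      have hle : Submodule.span ℝ
          ({Matrix.toEuclideanLin (hardInstance m₁ m₂ dbar L ε β).A.transpose
            (hardInstance m₁ m₂ dbar L ε β).b} ∪
          ⋃ s : Fin t, {x s, gradient (hardInstance m₁ m₂ dbar L ε β).f₀ (x s),
            Matrix.toEuclideanLin (hardInstance m₁ m₂ dbar L ε β).A.transpose
              (Matrix.toEuclideanLin (hardInstance m₁ m₂ dbar L ε β).A (x s))}) ≤
          LinearMap.ker (EuclideanSpace.proj (i, k) :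
            EuclideanSpace ℝ (Fin (3 * m₁ * m₂) × Fin dbar) →L[ℝ] ℝ).toLinearMap := by
        rw [Submodule.span_le]
        rintro w (hw | hw)
        · rw [Set.mem_singleton_iff] at hw
          subst hw
          simp [hardInstance]
        · obtain ⟨s, hs⟩ := Set.mem_iUnion.1 hw
          have hst := s.2
          have hxs : ∀ (i : Fin (3 * m₁ * m₂)) (k : Fin dbar),
              (s : ℕ) < activation m₁ m₂ (k + 1) i → x s (i, k) = 0 := fun i k h => ih s hst i k h
          rcases hs with rfl | rfl | rfl
          · exact hxs i k (by omega)
          · rw [hardInstance_f₀ hd]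
            exact gradient_apply_eq_zero hm₁ _ _ hxs i k (by omega)
          · refine hardA_transpose_mul_self_apply_eq_zero (x s) i k ?_
            intro r hr
            have h2 := activation_succ_of_not_dvd m₂ (k + 1) r.2
            have h3 : (s : ℕ) < activation m₁ m₂ (k + 1) (r.1 + 1) ∧
                (s : ℕ) < activation m₁ m₂ (k + 1) r.1 := by
              rcases hr with rfl | rfl
              · simp only [hi] at hik
                omega
              · simp only [lo] at hik
                omega
            exact ⟨hxs _ k h3.1, hxs _ k h3.2⟩
      exact hle hξ
    have hζ0 := hprox.eq_zero_of_closed hN hL hβ hη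
      (fun p => t < activation m₁ m₂ (p.2 + 1) p.1)
      (fun r k => by
        simp only [hi, lo]
        rw [activation_succ_of_dvd m₂ _ r.2])
      (fun p hp => hξ0 p.1 p.2 hp)
    obtain ⟨s, s', hs⟩ := Submodule.mem_span_pair.1 hxt
    have h1 := hξ0 i k hik
    have h2 := hζ0 (i, k) hik
    rw [← hs]
    simp [h1, h2]

/-- The number of iterations needed to reach the last coordinate. -/
theorem mul_le_of_activation_le (hm₁ : 2 ≤ m₁) (hd5 : 5 ≤ dbar) {t i : ℕ}
    (h : activation m₁ m₂ dbar i ≤ t) : m₁ * m₂ * dbar ≤ 5 * t := by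
  obtain ⟨n, rfl⟩ : ∃ n, dbar = n + 5 := ⟨dbar - 5, by omega⟩
  obtain ⟨D, hD⟩ : ∃ D, m₁ * m₂ = D + m₂ := ⟨m₁ * m₂ - m₂, by
    have : m₂ ≤ m₁ * m₂ := Nat.le_mul_of_pos_left _ (by omega)
    omega⟩
  have h1 : 2 * m₂ ≤ m₁ * m₂ := Nat.mul_le_mul_right _ hm₁
  rw [activation, if_neg (by omega), hD, Nat.add_sub_cancel] at h
  have h2 : m₂ ≤ D := by omega
  have h3 : (n + 5 - 2) * (D + 1) ≤ t := by omega
  rw [hD]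
  rw [show n + 5 - 2 = n + 3 by omega] at h3
  -- From `m₂ ≤ D`, `m₁m₂ d̄ ≤ 2D(n + 5)`, and `2(n + 5) ≤ 5(n + 3)`.
  nlinarith

end

section

/-! ### Translation of the variable -/

namespace Problem

variable {ι κ κ' : Type} [Fintype ι] [Fintype κ] [Fintype κ'] [DecidableEq ι]

theorem translate_g (P : Problem ι κ κ') (c x : EuclideanSpace ℝ ι) :
    (P.translate c).g x = P.g (x - c) := by
  simp only [g, translate, map_sub]
  congr 1
  abel

theorem translate_F₀ (P : Problem ι κ κ') (c x : EuclideanSpace ℝ ι) :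
    (P.translate c).F₀ x = P.F₀ (x - c) := by
  rw [F₀, translate_g]
  rfl

theorem iInf_translate_F₀ (P : Problem ι κ κ') (c : EuclideanSpace ℝ ι) :
    ⨅ x, (P.translate c).F₀ x = ⨅ x, P.F₀ x := by
  simp only [translate_F₀]
  exact (Equiv.subRight c).iInf_congr fun _ => rfl

theorem translate_gap (P : Problem ι κ κ') (c : EuclideanSpace ℝ ι) :
    (P.translate c).gap c = P.gap 0 := by
  rw [gap, gap, iInf_translate_F₀, translate_F₀, sub_self]

theorem gradient_translate (P : Problem ι κ κ') (c x : EuclideanSpace ℝ ι) :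
    gradient (P.translate c).f₀ x = gradient P.f₀ (x - c) := by
  simp only [gradient, translate]
  rw [fderiv_comp_sub]

theorem Admissible.translate {P : Problem ι κ κ'} {L : ℝ} (h : P.Admissible L)
    (c : EuclideanSpace ℝ ι) : (P.translate c).Admissible L where
  differentiable := h.differentiable.comp (differentiable_id.sub_const c)
  gradient_lipschitz x x' := by
    rw [gradient_translate, gradient_translate]
    simpa using h.gradient_lipschitz (x - c) (x' - c)
  bounded_below := by
    rw [iInf_translate_F₀]
    exact h.bounded_below
  proper_g := by
    refine h.proper_gbar.comp_affine _ _ ?_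
    obtain ⟨x, hx⟩ := h.proper_g.exists_ne_top
    refine ⟨x + c, ?_⟩
    have := P.translate_g c (x + c)
    rw [add_sub_cancel_right] at this
    rwa [← this] at hx
  proper_gbar := h.proper_gbar

theorem subdifferential_translate (P : Problem ι κ κ') (c x : EuclideanSpace ℝ ι) :
    subdifferential (P.translate c).g x ⊆ subdifferential P.g (x - c) := by
  rintro v ⟨h1, h2⟩
  refine ⟨by rwa [translate_g] at h1, fun y => ?_⟩
  have := h2 (y + c)
  rwa [translate_g, translate_g, add_sub_cancel_right, show y + c - x = y - (x - c) by abel] at this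

theorem IsStationary.of_translate [DecidableEq κ] {P : Problem ι κ κ'} {c x : EuclideanSpace ℝ ι} {ε : ℝ}
    (h : (P.translate c).IsStationary ε x) : P.IsStationary ε (x - c) := by
  obtain ⟨γ, h1, h2⟩ := h
  refine ⟨γ, le_trans (Metric.infEDist_anti ?_) h1, ?_⟩
  · rw [gradient_translate]
    exact Set.image_mono (P.subdifferential_translate c x)
  · convert h2 using 2
    simp only [translate, map_sub]
    abel

theorem IsNearStationary.of_translate [DecidableEq κ] {P : Problem ι κ κ'} {c x : EuclideanSpace ℝ ι} {ω ε : ℝ}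
    (h : (P.translate c).IsNearStationary ω ε x) : P.IsNearStationary ω ε (x - c) := by
  obtain ⟨x', h1, h2⟩ := h
  exact ⟨x' - c, h1.of_translate, by simpa using h2⟩

end Problem

/-! ### The oracle bound and the final theorem -/

variable {m₁ m₂ dbar : ℕ} {L ε β : ℝ}

/-- The oracle lower bound for methods started at the origin. -/
theorem ceil_le_of_isNearStationary (hε : 0 < ε) (hL : 0 < L) (hm₁ : 2 ≤ m₁) (hm₂ : 1 ≤ m₂)
    (hd : 5 ≤ dbar) (hdodd : Odd dbar)
    (hβ : (50 * Real.pi + 1) * √((3 * m₁ * m₂ : ℕ) : ℝ) * ε < β) {ω : ℝ}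
    (hω : ω < 150 * Real.pi * ε / L)
    {x : ℕ → EuclideanSpace ℝ (Fin (3 * m₁ * m₂) × Fin dbar)} (hx0 : x 0 = 0)
    (hx : (hardInstance m₁ m₂ dbar L ε β).LinearSpan x) {t : ℕ}
    (ht : (hardInstance m₁ m₂ dbar L ε β).IsNearStationary ω ε (x t)) :
    ⌈(hardInstance m₁ m₂ dbar L ε β).jointCond * L * (hardInstance m₁ m₂ dbar L ε β).gap 0 /
      (36000 * Real.pi ^ 2 * ε ^ 2)⌉₊ ≤ t := by
  have hN : 0 < 3 * m₁ * m₂ := by positivity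
  have hβ0 : 0 ≤ β := le_trans (by positivity) hβ.le
  obtain ⟨i, k, hk, hne⟩ := exists_last_ne_zero hN hL hε hβ hdodd hω (x t) ht
  have h1 : activation m₁ m₂ dbar i ≤ t := by
    by_contra! h
    exact hne (LinearSpan.eq_zero_of_lt_activation hN (by omega) hL hβ0 hdodd hx0 hx t i k
      (by rwa [hk]))
  have h2 : ((m₁ * m₂ * dbar : ℕ) : ℝ) ≤ ((5 * t : ℕ) : ℝ) := by
    exact_mod_cast mul_le_of_activation_le hm₁ hd h1
  have hcond : (hardInstance m₁ m₂ dbar L ε β).jointCond ≤ 2 * ((3 * m₁ * m₂ : ℕ) : ℝ) :=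
    condNumber_hard_le m₁ m₂ hL hN
  have hcond0 : 0 ≤ (hardInstance m₁ m₂ dbar L ε β).jointCond := Real.sqrt_nonneg _
  have hgap := hardInstance_gap_le (m₁ := m₁) (m₂ := m₂) hN hL hε hβ0 hdodd
  rw [Nat.ceil_le, div_le_iff₀ (by positivity)]
  -- The constants multiply as `2 · 3 · 1200 = 7200` and `7200 · 5 = 36000`.
  calc _ ≤ (hardInstance m₁ m₂ dbar L ε β).jointCond * L *
        (1200 * Real.pi ^ 2 * ε ^ 2 * dbar / L) :=
        mul_le_mul_of_nonneg_left hgap (mul_nonneg hcond0 hL.le)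
    _ ≤ 2 * ((3 * m₁ * m₂ : ℕ) : ℝ) * L * (1200 * Real.pi ^ 2 * ε ^ 2 * dbar / L) := by gcongr
    _ = 7200 * (Real.pi ^ 2 * ε ^ 2) * ((m₁ * m₂ * dbar : ℕ) : ℝ) := by
        push_cast
        field_simp
        ring
    _ ≤ 7200 * (Real.pi ^ 2 * ε ^ 2) * ((5 * t : ℕ) : ℝ) := by gcongr
    _ = _ := by push_cast; ring

end

end LowerBound

end

theorem mainTheorem1 (ε L : ℝ) (hε : 0 < ε) (hL : 0 < L)
    (m₁ m₂ dbar : ℕ) (hm₁ : 2 ≤ m₁) (hm₂ : 1 ≤ m₂) (hm : Even (m₁ * m₂))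
    (hd : 5 ≤ dbar) (hdodd : Odd dbar) (β : ℝ)
    (hβ : (50 * Real.pi + 1 + LowerBound.spectralNorm (LowerBound.hardA m₁ m₂ dbar L)) *
      √((3 * m₁ * m₂ : ℕ) : ℝ) * ε < β)
    (P : LowerBound.Problem (Fin (3 * m₁ * m₂) × Fin dbar)
      (LowerBound.RowMc m₁ m₂ × Fin dbar) (LowerBound.RowM m₁ m₂ × Fin dbar))
    (hP : P = LowerBound.hardInstance m₁ m₂ dbar L ε β) :
    -- the instance, and each of its translates, belongs to the problem class
    P.Admissible L ∧ (∀ x, P.F₀ x ≠ ⊤) ∧ (∀ c, (P.translate c).Admissible L) ∧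
    -- the lower bound for methods started at the origin
    (∀ ω : ℝ, 0 ≤ ω → ω < 150 * Real.pi * ε / L →
      ∀ x : ℕ → EuclideanSpace ℝ (Fin (3 * m₁ * m₂) × Fin dbar),
        x 0 = 0 → P.LinearSpan x →
        ∀ t : ℕ, P.IsNearStationary ω ε (x t) →
          ⌈P.jointCond * L * P.gap (x 0) / (36000 * Real.pi ^ 2 * ε ^ 2)⌉₊ ≤ t) ∧
    -- an arbitrary starting point, with the instance translated to it: the linear-span condition
    -- is imposed after the change of variables `x ↦ x - x 0`
    (∀ ω : ℝ, 0 ≤ ω → ω < 150 * Real.pi * ε / L →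
      ∀ x : ℕ → EuclideanSpace ℝ (Fin (3 * m₁ * m₂) × Fin dbar),
        P.LinearSpan (fun t => x t - x 0) →
        ∀ t : ℕ, (P.translate (x 0)).IsNearStationary ω ε (x t) →
          ⌈(P.translate (x 0)).jointCond * L * (P.translate (x 0)).gap (x 0) /
            (36000 * Real.pi ^ 2 * ε ^ 2)⌉₊ ≤ t) := by
  subst hP
  have hN : 0 < 3 * m₁ * m₂ := by positivity
  have hβ' : (50 * Real.pi + 1) * √((3 * m₁ * m₂ : ℕ) : ℝ) * ε < β := by
    refine lt_of_le_of_lt ?_ hβ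
    refine mul_le_mul_of_nonneg_right (mul_le_mul_of_nonneg_right ?_ (Real.sqrt_nonneg _)) hε.le
    exact le_add_of_nonneg_right (norm_nonneg _)
  have hβ0 : 0 ≤ β := le_trans (by positivity) hβ'.le
  have hadm := LowerBound.hardInstance_admissible (m₁ := m₁) (m₂ := m₂) hN hL hε hβ0 hdodd
  refine ⟨hadm, fun x => ?_, fun c => hadm.translate c, ?_, ?_⟩
  · rw [LowerBound.hardInstance_F₀ hN hL]
    exact EReal.coe_ne_top _
  · intro ω _ hω x hx0 hx t ht
    rw [hx0]
    exact LowerBound.ceil_le_of_isNearStationary hε hL hm₁ hm₂ hd hdodd hβ' hω hx0 hx ht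
  · intro ω _ hω x hx t ht
    rw [LowerBound.Problem.translate_gap]
    exact LowerBound.ceil_le_of_isNearStationary hε hL hm₁ hm₂ hd hdodd hβ' hω (sub_self _) hx
      ht.of_translate
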